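/- Let $B$ be a $C^*$-algebra (not necessarily unital) and $E$ a Hilbert $B$-module with $B$-valued inner product $\langle\cdot,\cdot\rangle$. Operators are $B$-linear maps $A:\mathcal D(A)\to E$ on submodules $\mathcal D(A)\subset E$. A densely defined operator $A$ is self-adjoint if $A=A^*$; a self-adjoint $A$ is regular if $A+z$ and $A-z$ have dense range for one (equivalently every) $z\in\mathbb C\setminus\mathbb R$. For self-adjoint regular operators $S,T$ in $E$ put $$\mathcal F=\mathcal F(S,T)=\{x\in\mathcal D(S)\cap\mathcal D(T)\mid Sx\in\mathcal D(T),\ Tx\in\mathcal D(S)\},\qquad [S,T]x=STx+TSx\quad(x\in\mathcal F).$$ The pair $(S,T)$ is called weakly anticommuting if (a) there are constants $C_0,C_1,C_2>0$ such that $\langle [S,T]x,[S,T]x\rangle\le C_0\langle x,x\rangle+C_1\langle Sx,Sx\rangle+C_2\langle Tx,Tx\rangle$ in $B$ for all $x\in\mathcal F$; and (b) there are a core $\mathcal E\subset\mathcal D(T)$ for $T$ and $\lambda_0>0$ such that $(S+\lambda)^{-1}(\mathcal E)\subset\mathcal F$ for all $\lambda\in i\mathbb R$ with $|\lambda|\ge\lambda_0$.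 **Theorem.** Let $(S,T)$ be a weakly anticommuting pair of self-adjoint regular operators in $E$. Then $S+T$ is self-adjoint and regular on $\mathcal D(S)\cap\mathcal D(T)$; that is, for all $z\in\mathbb C\setminus\mathbb R$ and $y\in E$ the equation $Sx+Tx+zx=y$ has a unique solution $x\in\mathcal D(S)\cap\mathcal D(T)$. In more detail: 1. There is a constant $C>0$ such that for all $x\in\mathcal D(S)\cap\mathcal D(T)$ $$C^{-1}\big(\langle x,x\rangle+\langle (S+T)x,(S+T)x\rangle\big)\le\langle x,x\rangle+\langle Sx,Sx\rangle+\langle Tx,Tx\rangle\le C\big(\langle x,x\rangle+\langle (S+T)x,(S+T)x\rangle\big).$$ 2. There is $\lambda_0>0$ such that for all $\lambda,\mu\in i\mathbb R$ with $|\lambda|,|\mu|\ge\lambda_0$ $$(T+\mu)^{-1}(\mathcal D(S))=\mathcal F=(S+\lambda)^{-1}(\mathcal D(T)),\qquad \operatorname{ran}\big((T+\mu)^{-1}(S+\lambda)^{-1}\big)=\mathcal F=\operatorname{ran}\big((S+\lambda)^{-1}(T+\mu)^{-1}\big).$$ 3. There is $\lambda_0>0$ such that for all $\lambda,\mu\in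 i\mathbb R$ with $|\lambda|>|\mu|\ge\lambda_0$ and $\mu/\lambda>0$ the operator $$S+T+\tfrac{TS}{\lambda}+\mu:\ \mathcal F\to E$$ is bijective and its inverse is a bounded adjointable operator on $E$. Moreover, for fixed $\mu$, as $|\lambda|\to\infty$ along those $\lambda\in i\mathbb R$ with $|\lambda|>|\mu|$ and $\mu/\lambda>0$, $$(S+T+\mu)\big(S+T+\tfrac{TS}{\lambda}+\mu\big)^{-1}x\to x\ \text{ in norm for every }x\in E,$$ $$\big(S+T+\tfrac{TS}{\lambda}+\mu\big)^{-1}\to(S+T+\mu)^{-1}\ \text{ in operator norm}.$$ 4. $\mathcal F(S,T)$ is a core for $S$, for $T$ and for $S+T$. -/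

import Mathlib

open Filter Topology

namespace HilbertMod

section Basic

variable {E : Type*} [NormedAddCommGroup E] [NormedSpace ℂ E]

/-- The operator `A + z`, with domain `D(A)`. -/
noncomputable def shift (A : E →ₗ.[ℂ] E) (z : ℂ) : E →ₗ.[ℂ] E :=
  (z • (LinearMap.id : E →ₗ[ℂ] E)) +ᵥ A

theorem shift_apply (A : E →ₗ.[ℂ] E) (z : ℂ) (x : A.domain) :
    shift A z x = z • (x : E) + A x := rfl

/-- The set `A⁻¹(D)` of those `x ∈ D(A)` with `A x ∈ D`.  When `A : D(A) → E` is bijective, this is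
the image of `D` under the inverse operator `A⁻¹ : E → D(A)`. -/
def invImage (A : E →ₗ.[ℂ] E) (D : Set E) : Set E :=
  {x | ∃ y ∈ D, (x, y) ∈ A.graph}

/-- The submodule
`F(S,T) = {x ∈ D(S) ∩ D(T) | S x ∈ D(T), T x ∈ D(S)}`. -/
def domF (S T : E →ₗ.[ℂ] E) : Submodule ℂ E where
  carrier := {x | ∃ (hS : x ∈ S.domain) (hT : x ∈ T.domain),
    S ⟨x, hS⟩ ∈ T.domain ∧ T ⟨x, hT⟩ ∈ S.domain}
  zero_mem' := by
    refine ⟨S.domain.zero_mem, T.domain.zero_mem, ?_, ?_⟩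
    · have : S ⟨0, S.domain.zero_mem⟩ = 0 := S.map_zero
      rw [this]; exact T.domain.zero_mem
    · have : T ⟨0, T.domain.zero_mem⟩ = 0 := T.map_zero
      rw [this]; exact S.domain.zero_mem
  add_mem' := by
    rintro x y ⟨hS, hT, h1, h2⟩ ⟨kS, kT, k1, k2⟩
    refine ⟨S.domain.add_mem hS kS, T.domain.add_mem hT kT, ?_, ?_⟩
    · have : S ⟨x + y, S.domain.add_mem hS kS⟩ = S ⟨x, hS⟩ + S ⟨y, kS⟩ :=
        S.map_add ⟨x, hS⟩ ⟨y, kS⟩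
      rw [this]; exact T.domain.add_mem h1 k1
    · have : T ⟨x + y, T.domain.add_mem hT kT⟩ = T ⟨x, hT⟩ + T ⟨y, kT⟩ :=
        T.map_add ⟨x, hT⟩ ⟨y, kT⟩
      rw [this]; exact S.domain.add_mem h2 k2
  smul_mem' := by
    rintro c x ⟨hS, hT, h1, h2⟩
    refine ⟨S.domain.smul_mem c hS, T.domain.smul_mem c hT, ?_, ?_⟩
    · have : S ⟨c • x, S.domain.smul_mem c hS⟩ = c • S ⟨x, hS⟩ := S.map_smul c ⟨x, hS⟩
      rw [this]; exact T.domain.smul_mem c h1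
    · have : T ⟨c • x, T.domain.smul_mem c hT⟩ = c • T ⟨x, hT⟩ := T.map_smul c ⟨x, hT⟩
      rw [this]; exact S.domain.smul_mem c h2

theorem domF_le_left (S T : E →ₗ.[ℂ] E) : domF S T ≤ S.domain := fun _ hx => hx.1

theorem domF_le_right (S T : E →ₗ.[ℂ] E) : domF S T ≤ T.domain := fun _ hx => hx.2.1

/-- The restriction of `S` to `F(S,T)`. -/
def resS (S T : E →ₗ.[ℂ] E) : domF S T →ₗ[ℂ] E :=
  S.toFun.comp (Submodule.inclusion (domF_le_left S T))

/-- The restriction of `T` to `F(S,T)`. -/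
def resT (S T : E →ₗ.[ℂ] E) : domF S T →ₗ[ℂ] E :=
  T.toFun.comp (Submodule.inclusion (domF_le_right S T))

/-- The composition `x ↦ S (T x)` on `F(S,T)`. -/
def prodST (S T : E →ₗ.[ℂ] E) : domF S T →ₗ[ℂ] E :=
  S.toFun.comp ((resT S T).codRestrict S.domain fun x => x.2.2.2.2)

/-- The composition `x ↦ T (S x)` on `F(S,T)`. -/
def prodTS (S T : E →ₗ.[ℂ] E) : domF S T →ₗ[ℂ] E :=
  T.toFun.comp ((resS S T).codRestrict T.domain fun x => x.2.2.2.1)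

/-- The anticommutator `[S,T] = ST + TS` on `F(S,T)`. -/
def anticomm (S T : E →ₗ.[ℂ] E) : domF S T →ₗ[ℂ] E :=
  prodST S T + prodTS S T

/-- The operator `S + T + l⁻¹ T S + m` with domain `F(S,T)`. -/
noncomputable def approxOp (S T : E →ₗ.[ℂ] E) (l m : ℂ) : E →ₗ.[ℂ] E where
  domain := domF S T
  toFun := resS S T + resT S T + l⁻¹ • prodTS S T + m • (domF S T).subtype

/-- The directed set of those `l ∈ iℝ` with `|l| > |m|` and `m / l > 0`
(for `l, m ∈ iℝ` the quotient `m / l` is a real number). -/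
def paramSet (m : ℂ) : Set ℂ :=
  {l | l.re = 0 ∧ ‖m‖ < ‖l‖ ∧ 0 < (m / l).re}

/-- The limit `|l| → ∞` along the net `paramSet m`. -/
noncomputable def paramFilter (m : ℂ) : Filter ℂ :=
  Bornology.cobounded ℂ ⊓ 𝓟 (paramSet m)

end Basic

section Module

variable (B : Type*) [NonUnitalCStarAlgebra B] [PartialOrder B] [StarOrderedRing B]
  {E : Type*} [NormedAddCommGroup E] [NormedSpace ℂ E] [SMul B E] [CStarModule B E]

/-- `A` is a self-adjoint operator in the Hilbert `B`-module `E`: it is a densely defined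
`B`-linear operator (on a `B`-invariant domain) and coincides, including domains, with its
adjoint `A*`, where `A* y = z` means `⟨A x, y⟩ = ⟨x, z⟩` for all `x ∈ D(A)`. -/
structure IsSelfAdjointOp (A : E →ₗ.[ℂ] E) : Prop where
  dense_domain : Dense (A.domain : Set E)
  smul_mem_graph : ∀ (b : B) (x : A.domain), (b • (x : E), b • A x) ∈ A.graph
  mem_graph_iff : ∀ y z : E,
    (y, z) ∈ A.graph ↔ ∀ x : A.domain, inner B (A x) y = inner B (x : E) z

/-- `A` is a self-adjoint regular operator: it is self-adjoint, and `A + z` and `A - z` have dense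
range for one (equivalently, for every) non-real `z`. -/
structure IsSelfAdjointRegular (A : E →ₗ.[ℂ] E) : Prop where
  selfAdjoint : IsSelfAdjointOp B A
  regular : ∃ z : ℂ, z.im ≠ 0 ∧ DenseRange (shift A z) ∧ DenseRange (shift A (-z))

/-- `R` is a bounded adjointable operator of `E`. (An adjointable map is automatically
`B`-linear.) -/
def IsAdjointable (R : E →L[ℂ] E) : Prop :=
  ∃ R' : E →L[ℂ] E, ∀ x y : E, inner B (R x) y = inner B x (R' y)

/-- `A : D(A) → E` is bijective and its inverse is the bounded adjointable operator `R`. -/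
structure IsAdjointableInverse (A : E →ₗ.[ℂ] E) (R : E →L[ℂ] E) : Prop where
  adjointable : IsAdjointable B R
  left_inv : ∀ x : A.domain, R (A x) = x
  right_inv : ∀ y : E, (R y, y) ∈ A.graph

/-- The pair `(S,T)` of self-adjoint regular operators is weakly anticommuting. -/
structure IsWeaklyAnticommuting (S T : E →ₗ.[ℂ] E) : Prop where
  left : IsSelfAdjointRegular B S
  right : IsSelfAdjointRegular B T
  form_estimate : ∃ C₀ C₁ C₂ : ℝ, 0 < C₀ ∧ 0 < C₁ ∧ 0 < C₂ ∧ ∀ x : domF S T,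
    inner B (anticomm S T x) (anticomm S T x) ≤
      C₀ • inner B (x : E) (x : E) + C₁ • inner B (resS S T x) (resS S T x)
        + C₂ • inner B (resT S T x) (resT S T x)
  core : ∃ D : Submodule ℂ E, T.HasCore D ∧ ∃ l₀ : ℝ, 0 < l₀ ∧
    ∀ l : ℂ, l.re = 0 → l₀ ≤ ‖l‖ → invImage (shift S l) D ⊆ domF S T

end Module

end HilbertMod

open HilbertMod

/-! For large imaginary `l` the resolvent of `S` has norm at most `1/|l|` and `S(S+l)⁻¹` is a
contraction, and likewise for `T`. The anticommutator is of first order, so `[S,T](S+l)⁻¹(T+m)⁻¹`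
has norm below `1` once `|l|, |m|` are large.

Exchanging `S` and `T`. The hypothesis on a core says nothing about `(T+m)⁻¹`. A priori bounds and
closed graphs extend it from the core to `D(T)` (`res_mem_domF_of_core`). For `y ∈ D(S)` a Neumann
series then yields a candidate in `F` for `(T+m)⁻¹y`, and the anticommutator bound forces the
difference to vanish (`res_right_mem_domF`). From there on the situation is symmetric.

Graph norms. On `F`, `⟨(S+T)x,(S+T)x⟩ = ⟨Sx,Sx⟩ + ⟨Tx,Tx⟩ + ⟨x,[S,T]x⟩`, and completing a square
absorbs the last term. The elements `l(S+l)⁻¹x` lie in `F` and converge to `x` in both graph norms,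
so the estimate passes to `D(S) ∩ D(T)`, and `F` is a core. In particular `S+T` is closed.

Surjectivity. `S+T+TS/l+m = l⁻¹(T+l)(S+l) - (l-m)` is invertible by a Neumann series
(`exists_approx_inverse`). All cross terms in the square of its values are anticommutators, so its
solutions `u` are bounded uniformly in `l` (`approx_bounds`). If the right side lies in `D(T)`, then
`‖TSu/l‖²` is `O(1/|l|)` (`approx_error_sq_le`). Hence `S+T+m` has dense and closed range. Norm
convergence of the inverses holds because `(S+T+m)⁻¹T` is bounded. -/

namespace HilbertMod

/-! ### Closed bounded relations and the Neumann series. -/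

section Relations

variable {X Y : Type*} [NormedAddCommGroup X] [NormedSpace ℂ X] [CompleteSpace X]
  [NormedAddCommGroup Y] [NormedSpace ℂ Y] [CompleteSpace Y]

/-- The domain of a bounded closed linear relation is closed. -/
theorem isClosed_image_fst (Γ : Submodule ℂ (X × Y)) (hΓ : IsClosed (Γ : Set (X × Y))) (C : ℝ)
    (hC : ∀ p ∈ Γ, ‖p.2‖ ≤ C * ‖p.1‖) : IsClosed (Prod.fst '' (Γ : Set (X × Y))) := by
  have hcomp : CompleteSpace Γ := hΓ.completeSpace_coe
  let f : Γ →L[ℂ] X := (ContinuousLinearMap.fst ℂ X Y).comp Γ.subtypeL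
  have hf : AntilipschitzWith (Real.toNNReal (max 1 C)) f := by
    refine AddMonoidHomClass.antilipschitz_of_bound f fun x => ?_
    have h1 : ‖(x : X × Y).2‖ ≤ C * ‖(x : X × Y).1‖ := hC x x.2
    rw [Real.coe_toNNReal _ (le_max_of_le_left zero_le_one)]
    change max ‖(x : X × Y).1‖ ‖(x : X × Y).2‖ ≤ _ * ‖(x : X × Y).1‖
    refine max_le ?_ (h1.trans ?_)
    · exact le_mul_of_one_le_left (norm_nonneg _) (le_max_left _ _)
    · gcongr; exact le_max_right _ _
  have := hf.isClosed_range f.uniformContinuous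
  convert this using 1
  ext x
  constructor
  · rintro ⟨p, hp, rfl⟩; exact ⟨⟨p, hp⟩, rfl⟩
  · rintro ⟨p, rfl⟩; exact ⟨p, p.2, rfl⟩

theorem exists_sub_eq_of_norm_lt_one {L : X →L[ℂ] X} (hL : ‖L‖ < 1) (y : X) :
    ∃ w, w - L w = y := by
  refine ⟨(↑(Units.oneSub L hL)⁻¹ : X →L[ℂ] X) y, ?_⟩
  have h := congrArg (fun f : X →L[ℂ] X => f y) (Units.oneSub L hL).mul_inv
  simpa using h

end Relations

/-! ### Graphs of shifts and sums; cores as closures of graphs. -/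

section Core

variable {E : Type*} [NormedAddCommGroup E] [NormedSpace ℂ E]

theorem mem_graph_of_mem {A : E →ₗ.[ℂ] E} {x : E} (h : x ∈ A.domain) :
    (x, A ⟨x, h⟩) ∈ A.graph := A.mem_graph ⟨x, h⟩

theorem apply_eq_of_mem_graph {A : E →ₗ.[ℂ] E} {x y : E} (h : (x, y) ∈ A.graph)
    (hx : x ∈ A.domain) : A ⟨x, hx⟩ = y :=
  A.mem_graph_snd_inj (mem_graph_of_mem hx) h rfl

theorem shift_apply_domain (A : E →ₗ.[ℂ] E) (z : ℂ) (w : (shift A z).domain) :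
    shift A z w = z • (w : E) + A ⟨w, w.2⟩ := rfl

theorem mem_graph_shift {A : E →ₗ.[ℂ] E} {z : ℂ} {x y : E} :
    (x, y) ∈ (shift A z).graph ↔ (x, y - z • x) ∈ A.graph := by
  constructor
  · intro h
    obtain ⟨w, rfl, rfl⟩ := (LinearPMap.mem_graph_iff _).1 h
    rw [shift_apply_domain, add_sub_cancel_left]
    exact mem_graph_of_mem (A := A) w.2
  · intro h
    obtain ⟨w, h1, h2⟩ := (LinearPMap.mem_graph_iff _).1 h
    refine (LinearPMap.mem_graph_iff _).2 ⟨w, h1, ?_⟩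
    rw [shift_apply, h2, h1]; simp

theorem exists_shift_apply {A : E →ₗ.[ℂ] E} {x u : E} (h : (x, u) ∈ A.graph) (z : ℂ) :
    ∃ w : (shift A z).domain, (w : E) = x ∧ shift A z w = u + z • x :=
  (LinearPMap.mem_graph_iff _).1 (mem_graph_shift.2 (by simpa using h))

theorem mem_graph_add {A A' : E →ₗ.[ℂ] E} {x y : E} :
    (x, y) ∈ (A + A').graph ↔ ∃ u v, (x, u) ∈ A.graph ∧ (x, v) ∈ A'.graph ∧ u + v = y := by
  constructor
  · intro h
    obtain ⟨⟨w, h1, h2⟩, rfl, rfl⟩ := (LinearPMap.mem_graph_iff _).1 h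
    exact ⟨_, _, mem_graph_of_mem h1, mem_graph_of_mem h2, rfl⟩
  · rintro ⟨u, v, hu, hv, rfl⟩
    have h1 := A.mem_domain_of_mem_graph hu
    have h2 := A'.mem_domain_of_mem_graph hv
    refine (LinearPMap.mem_graph_iff _).2 ⟨⟨x, h1, h2⟩, rfl, ?_⟩
    rw [LinearPMap.add_apply, apply_eq_of_mem_graph hu h1, apply_eq_of_mem_graph hv h2]

theorem mem_graph_domRestrict {A : E →ₗ.[ℂ] E} {D : Submodule ℂ E} {x y : E} :
    (x, y) ∈ (A.domRestrict D).graph ↔ x ∈ D ∧ (x, y) ∈ A.graph := by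
  constructor
  · intro h
    obtain ⟨⟨w, h1, h2⟩, rfl, rfl⟩ := (LinearPMap.mem_graph_iff _).1 h
    refine ⟨h1, ?_⟩
    have : A.domRestrict D ⟨w, h1, h2⟩ = A ⟨w, h2⟩ := LinearPMap.domRestrict_apply rfl
    rw [this]; exact mem_graph_of_mem h2
  · rintro ⟨hx, h⟩
    have h2 := A.mem_domain_of_mem_graph h
    refine (LinearPMap.mem_graph_iff _).2 ⟨⟨x, hx, h2⟩, rfl, ?_⟩
    exact (LinearPMap.domRestrict_apply (f := A) (x := ⟨x, hx, h2⟩) (y := ⟨x, h2⟩) rfl).trans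
      (apply_eq_of_mem_graph h h2)

theorem hasCore_iff {A : E →ₗ.[ℂ] E} (hA : A.IsClosed) {D : Submodule ℂ E} :
    A.HasCore D ↔ D ≤ A.domain ∧
      ∀ x y, (x, y) ∈ A.graph → (x, y) ∈ closure {p : E × E | p.1 ∈ D ∧ p ∈ A.graph} := by
  have hcl : (A.domRestrict D).IsClosable :=
    hA.isClosable.leIsClosable LinearPMap.domRestrict_le
  have hset : {p : E × E | p.1 ∈ D ∧ p ∈ A.graph} = ((A.domRestrict D).graph : Set (E × E)) := by
    ext ⟨x, y⟩
    exact mem_graph_domRestrict.symm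
  have hgr := hcl.graph_closure_eq_closure_graph
  rw [hset]
  constructor
  · intro h
    refine ⟨h.le_domain, fun x y hxy => ?_⟩
    rw [h.closure_eq] at hgr
    rw [← hgr] at hxy
    exact hxy
  · rintro ⟨h1, h2⟩
    refine ⟨h1, LinearPMap.eq_of_eq_graph ?_⟩
    rw [← hgr]
    apply le_antisymm
    · refine Submodule.topologicalClosure_minimal _ ?_ hA
      rintro ⟨x, y⟩ hxy
      exact (mem_graph_domRestrict.1 hxy).2
    · rintro ⟨x, y⟩ hxy
      exact h2 x y hxy

theorem hasCore_of_tendsto {A : E →ₗ.[ℂ] E} (hA : A.IsClosed) {D : Submodule ℂ E}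
    (hD : D ≤ A.domain)
    (h : ∀ x y, (x, y) ∈ A.graph → ∃ u v : ℕ → E, (∀ᶠ n in atTop, u n ∈ D) ∧
      (∀ᶠ n in atTop, (u n, v n) ∈ A.graph) ∧
      Tendsto u atTop (𝓝 x) ∧ Tendsto v atTop (𝓝 y)) : A.HasCore D := by
  refine (hasCore_iff hA).2 ⟨hD, fun x y hxy => ?_⟩
  obtain ⟨u, v, h1, h2, h3, h4⟩ := h x y hxy
  exact mem_closure_of_tendsto (h3.prodMk_nhds h4) (h1.and h2)

end Core

/-! ### Symmetry and lower bounds for `A + z`. -/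

section Inner

variable (B : Type*) [NonUnitalCStarAlgebra B] [PartialOrder B] [StarOrderedRing B]
  {E : Type*} [NormedAddCommGroup E] [NormedSpace ℂ E] [SMul B E] [CStarModule B E]

open CStarModule

omit [StarOrderedRing B] in
theorem inner_right_ext {y z : E} (h : ∀ x : E, inner B x y = inner B x z) : y = z := by
  rw [← sub_eq_zero, ← CStarModule.inner_self (A := B)]
  rw [CStarModule.inner_sub_right, h, sub_self]

theorem norm_le_of_inner_le {x y : E} (h : inner B x x ≤ inner B y y) : ‖x‖ ≤ ‖y‖ := by
  have := CStarAlgebra.norm_le_norm_of_nonneg_of_le (CStarModule.inner_self_nonneg (x := x)) h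
  rw [← norm_sq_eq, ← norm_sq_eq] at this
  exact le_of_sq_le_sq this (norm_nonneg _)

theorem norm_le_left_of_inner_eq_add {x y w : E}
    (h : inner B y y = inner B x x + inner B w w) : ‖x‖ ≤ ‖y‖ :=
  norm_le_of_inner_le B (h ▸ le_add_of_nonneg_right CStarModule.inner_self_nonneg)

theorem norm_le_right_of_inner_eq_add {x y w : E}
    (h : inner B y y = inner B x x + inner B w w) : ‖w‖ ≤ ‖y‖ :=
  norm_le_of_inner_le B (h ▸ le_add_of_nonneg_left CStarModule.inner_self_nonneg)

-- The cross terms carrying `Im z` cancel by symmetry. Since the identity holds in `B`, order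
-- comparison gives the norm bounds without passing to states.
omit [StarOrderedRing B] in
theorem inner_add_smul_self {x u : E} (h : inner B u x = inner B x u) (z : ℂ) :
    inner B (u + z • x) (u + z • x) = inner B (u + (z.re : ℂ) • x) (u + (z.re : ℂ) • x)
      + inner B ((z.im : ℂ) • x) ((z.im : ℂ) • x) := by
  simp only [CStarModule.inner_add_left, CStarModule.inner_add_right, CStarModule.inner_smul_left_complex,
    CStarModule.inner_smul_right_complex, h]
  match_scalars <;> apply Complex.ext <;> simp <;> ring

omit [StarOrderedRing B] in
theorem inner_add_smul_self_of_re_eq_zero {x u : E} (h : inner B u x = inner B x u) {z : ℂ}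
    (hz : z.re = 0) :
    inner B (u + z • x) (u + z • x) = inner B u u + inner B (z • x) (z • x) := by
  simp only [CStarModule.inner_add_left, CStarModule.inner_add_right, CStarModule.inner_smul_left_complex,
    CStarModule.inner_smul_right_complex, h]
  match_scalars <;> apply Complex.ext <;> simp [hz]

variable {B}

namespace IsSelfAdjointOp

variable {A : E →ₗ.[ℂ] E} (hA : IsSelfAdjointOp B A)
include hA

omit [StarOrderedRing B] in
theorem symm {x u y v : E} (h1 : (x, u) ∈ A.graph) (h2 : (y, v) ∈ A.graph) :
    inner B u y = inner B x v := by
  obtain ⟨w, rfl, rfl⟩ := (LinearPMap.mem_graph_iff _).1 h1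
  exact (hA.mem_graph_iff y v).1 h2 w

theorem isClosed : A.IsClosed := by
  have : (A.graph : Set (E × E)) =
      ⋂ x : A.domain, {p : E × E | inner B (A x) p.1 = inner B (x : E) p.2} := by
    ext ⟨y, z⟩
    simp only [SetLike.mem_coe, Set.mem_iInter, Set.mem_ofPred_eq]
    exact hA.mem_graph_iff y z
  rw [LinearPMap.IsClosed, this]
  refine isClosed_iInter fun x => isClosed_eq ?_ ?_
  · exact (continuous_inner (A := B)).comp (continuous_const.prodMk continuous_fst)
  · exact (continuous_inner (A := B)).comp (continuous_const.prodMk continuous_snd)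

theorem norm_smul_le {x u : E} (h : (x, u) ∈ A.graph) {z : ℂ} (hz : z.re = 0) :
    ‖z‖ * ‖x‖ ≤ ‖u + z • x‖ := by
  rw [← norm_smul]
  exact norm_le_right_of_inner_eq_add B (inner_add_smul_self_of_re_eq_zero B (hA.symm h h) hz)

theorem norm_apply_le {x u : E} (h : (x, u) ∈ A.graph) {z : ℂ} (hz : z.re = 0) :
    ‖u‖ ≤ ‖u + z • x‖ :=
  norm_le_left_of_inner_eq_add B (inner_add_smul_self_of_re_eq_zero B (hA.symm h h) hz)

theorem norm_im_smul_le {x u : E} (h : (x, u) ∈ A.graph) (z : ℂ) :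
    |z.im| * ‖x‖ ≤ ‖u + z • x‖ := by
  have := norm_le_right_of_inner_eq_add B (inner_add_smul_self B (hA.symm h h) z)
  rw [norm_smul] at this
  simpa using this

end IsSelfAdjointOp

end Inner

/-! ### Resolvents of self-adjoint regular operators. -/

section Resolvent

variable {B : Type*} [NonUnitalCStarAlgebra B] [PartialOrder B] [StarOrderedRing B]
  {E : Type*} [NormedAddCommGroup E] [NormedSpace ℂ E] [CompleteSpace E]
  [SMul B E] [CStarModule B E]

open CStarModule

/-- `R` is the bounded everywhere defined inverse of `A + z`. -/
structure IsRes (A : E →ₗ.[ℂ] E) (z : ℂ) (R : E →L[ℂ] E) : Prop where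
  mem_graph : ∀ y, (R y, y - z • R y) ∈ A.graph
  apply_add : ∀ x u, (x, u) ∈ A.graph → R (u + z • x) = x

/-- `A + z` is surjective. -/
def ShiftSurj (A : E →ₗ.[ℂ] E) (z : ℂ) : Prop :=
  ∀ y, ∃ x u, (x, u) ∈ A.graph ∧ u + z • x = y

omit [CompleteSpace E] in
theorem IsSelfAdjointOp.exists_isRes {A : E →ₗ.[ℂ] E} (hA : IsSelfAdjointOp B A) {z : ℂ}
    (hz : z.im ≠ 0) (hs : ShiftSurj A z) : ∃ R, IsRes A z R ∧ ‖R‖ ≤ |z.im|⁻¹ := by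
  have hpos : 0 < |z.im| := abs_pos.2 hz
  have hinj : ∀ x u x' u', (x, u) ∈ A.graph → (x', u') ∈ A.graph → u + z • x = u' + z • x' →
      x = x' := by
    intro x u x' u' h h' he
    have h1 := hA.norm_im_smul_le (A.graph.sub_mem h h') z
    have h2 : u - u' + z • (x - x') = 0 := by
      rw [smul_sub, ← sub_eq_zero.2 he]; abel
    simp only at h1
    rw [h2, norm_zero] at h1
    have h3 : ‖x - x'‖ ≤ 0 := nonpos_of_mul_nonpos_right h1 hpos
    exact sub_eq_zero.1 (norm_le_zero_iff.1 h3)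
  choose f g hfg hfg' using hs
  let R₀ : E →ₗ[ℂ] E :=
    { toFun := f
      map_add' := fun x y => by
        refine hinj _ _ _ _ (hfg _) (A.graph.add_mem (hfg x) (hfg y)) ?_
        simp only
        rw [hfg', smul_add, add_add_add_comm, hfg', hfg']
      map_smul' := fun c x => by
        refine hinj _ _ _ _ (hfg _) (A.graph.smul_mem c (hfg x)) ?_
        simp only [RingHom.id_apply]
        rw [hfg', smul_comm, ← smul_add, hfg'] }
  have hb : ∀ x, ‖R₀ x‖ ≤ |z.im|⁻¹ * ‖x‖ := by
    intro x
    have := hA.norm_im_smul_le (hfg x) z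
    rw [hfg'] at this
    rwa [← div_eq_inv_mul, le_div_iff₀' hpos]
  refine ⟨R₀.mkContinuous _ hb, ⟨fun y => ?_, fun x u h => ?_⟩,
    R₀.mkContinuous_norm_le (inv_nonneg.2 hpos.le) hb⟩
  · change (f y, y - z • f y) ∈ A.graph
    have : y - z • f y = g y := by rw [sub_eq_iff_eq_add]; exact (hfg' y).symm
    rw [this]; exact hfg y
  · change f _ = x
    exact hinj _ _ _ _ (hfg _) h (hfg' _)

/-- The inverse relation of `A + z` is closed and bounded, so its domain, which is the range of `A +
z`, is closed. -/
theorem shiftSurj_of_denseRange {A : E →ₗ.[ℂ] E} (hc : A.IsClosed) {z : ℂ} {k : ℝ}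
    (hk : ∀ x u, (x, u) ∈ A.graph → ‖x‖ ≤ k * ‖u + z • x‖) (hd : DenseRange (shift A z)) :
    ShiftSurj A z := by
  let f : E × E →L[ℂ] E × E :=
    (ContinuousLinearMap.snd ℂ E E).prod
      (ContinuousLinearMap.fst ℂ E E - z • ContinuousLinearMap.snd ℂ E E)
  have hcl : IsClosed (Prod.fst '' ((A.graph.comap f.toLinearMap : Submodule ℂ (E × E)) :
      Set (E × E))) := by
    refine isClosed_image_fst _ (hc.preimage f.continuous) k ?_
    rintro ⟨y, x⟩ h
    have h' : (x, y - z • x) ∈ A.graph := h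
    simpa using hk _ _ h'
  intro y
  have hy : y ∈ Prod.fst '' ((A.graph.comap f.toLinearMap : Submodule ℂ (E × E)) :
      Set (E × E)) := by
    refine closure_minimal ?_ hcl (hd y)
    rintro _ ⟨w, rfl⟩
    refine ⟨(shift A z w, (w : E)), ?_, rfl⟩
    change ((w : E), shift A z w - z • (w : E)) ∈ A.graph
    rw [shift_apply_domain, add_sub_cancel_left]
    exact mem_graph_of_mem (A := A) w.2
  obtain ⟨⟨y', x⟩, h, rfl⟩ := hy
  exact ⟨x, y' - z • x, h, by simp⟩

/-- With `R = (A+z)⁻¹` one has `(A+z')R = 1 + (z'-z)R`, invertible because `‖R‖ ≤ 1/|Im z|`. -/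
theorem IsSelfAdjointOp.shiftSurj_of_near {A : E →ₗ.[ℂ] E} (hA : IsSelfAdjointOp B A) {z z' : ℂ}
    (hz : ‖z' - z‖ < |z.im|) (hs : ShiftSurj A z) : ShiftSurj A z' := by
  have hpos : 0 < |z.im| := (norm_nonneg _).trans_lt hz
  obtain ⟨R, hR, hRn⟩ := hA.exists_isRes (abs_pos.1 hpos) hs
  intro y
  have hL : ‖(-(z' - z)) • R‖ < 1 := by
    calc ‖(-(z' - z)) • R‖ ≤ ‖z' - z‖ * |z.im|⁻¹ := by
          rw [norm_smul, norm_neg]; gcongr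
      _ < 1 := by rwa [← div_eq_mul_inv, div_lt_one hpos]
  obtain ⟨w, hw⟩ := exists_sub_eq_of_norm_lt_one hL y
  refine ⟨R w, w - z • R w, hR.mem_graph w, ?_⟩
  rw [← hw]
  simp only [smul_apply]
  module

/-- The good points are open and relatively closed in an open half plane, which is connected. -/
theorem IsSelfAdjointOp.shiftSurj_of_same_sign {A : E →ₗ.[ℂ] E} (hA : IsSelfAdjointOp B A)
    {z z' : ℂ} (hz : 0 < z.im * z'.im) (hs : ShiftSurj A z) : ShiftSurj A z' := by
  let H : Set ℂ := {w | 0 < z.im * w.im}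
  let Z : Set ℂ := {w | w ∈ H ∧ ShiftSurj A w}
  have hne : z.im ≠ 0 := fun h => by simp [h] at hz
  have him : ∀ w ∈ H, w.im ≠ 0 := fun w (hw : 0 < z.im * w.im) h => by simp [h] at hw
  have hH : IsPreconnected H := by
    apply Convex.isPreconnected
    intro a ha b hb s t hs ht hst
    have ha' : 0 < z.im * a.im := ha
    have hb' : 0 < z.im * b.im := hb
    change 0 < z.im * (s • a + t • b).im
    have : z.im * (s • a + t • b).im = s * (z.im * a.im) + t * (z.im * b.im) := by
      simp; ring
    rw [this]
    rcases hs.eq_or_lt with rfl | hs'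
    · have : t = 1 := by linarith
      subst this; simpa using hb'
    · positivity
  have hHo : IsOpen H := isOpen_lt continuous_const (continuous_const.mul Complex.continuous_im)
  have hZo : IsOpen Z := by
    rw [Metric.isOpen_iff]
    intro w hw
    obtain ⟨ε, hε, hε'⟩ := Metric.isOpen_iff.1 hHo w hw.1
    refine ⟨min ε |w.im|, lt_min hε (abs_pos.2 (him w hw.1)), fun v hv => ⟨hε' ?_, ?_⟩⟩
    · exact Metric.ball_subset_ball (min_le_left _ _) hv
    · refine hA.shiftSurj_of_near (z := w) ?_ hw.2
      rw [← dist_eq_norm]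
      exact (Metric.mem_ball.1 hv).trans_le (min_le_right _ _)
  have hsub : H ⊆ Z := by
    refine hH.subset_of_closure_inter_subset hZo ⟨z, ?_, ?_, hs⟩ ?_
    · exact mul_self_pos.2 hne
    · exact mul_self_pos.2 hne
    · rintro w ⟨hw, hwH⟩
      refine ⟨hwH, ?_⟩
      have hw0 := abs_pos.2 (him w hwH)
      -- Within this radius `|Im v| > |Im w|/2`, so `w` lies in the disc around `v` covered by the
      -- Neumann series.
      obtain ⟨v, hv, hvw⟩ := Metric.mem_closure_iff.1 hw (|w.im| / 2) (by positivity)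
      refine hA.shiftSurj_of_near (z := v) ?_ hv.2
      rw [← dist_eq_norm]
      have h1 : |(w - v).im| ≤ ‖w - v‖ := Complex.abs_im_le_norm _
      rw [← dist_eq_norm, Complex.sub_im] at h1
      have h2 : |w.im| ≤ |v.im| + |w.im - v.im| := by
        simpa using abs_add_le v.im (w.im - v.im)
      linarith
  exact (hsub (show z' ∈ H from hz)).2

theorem IsSelfAdjointRegular.shiftSurj {A : E →ₗ.[ℂ] E} (hA : IsSelfAdjointRegular B A) {z : ℂ}
    (hz : z.im ≠ 0) : ShiftSurj A z := by
  obtain ⟨w, hw, h1, h2⟩ := hA.regular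
  have key : ∀ v : ℂ, v.im ≠ 0 → DenseRange (shift A v) → ShiftSurj A v := fun v hv hd =>
    shiftSurj_of_denseRange hA.selfAdjoint.isClosed (k := |v.im|⁻¹)
      (fun x u h => by
        rw [← div_eq_inv_mul, le_div_iff₀' (abs_pos.2 hv)]
        exact hA.selfAdjoint.norm_im_smul_le h v) hd
  have hne : z.im * w.im ≠ 0 := mul_ne_zero hz hw
  rcases lt_or_gt_of_ne hne with h | h
  · refine hA.selfAdjoint.shiftSurj_of_same_sign (z := -w) ?_ (key _ (by simpa using hw) h2)
    simp only [Complex.neg_im]; linarith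
  · refine hA.selfAdjoint.shiftSurj_of_same_sign (z := w) ?_ (key _ hw h1)
    linarith

open Classical in
/-- The resolvent `(A + z)⁻¹` (and `0` if `A + z` has no bounded inverse). -/
noncomputable def res (A : E →ₗ.[ℂ] E) (z : ℂ) : E →L[ℂ] E :=
  if h : ∃ R, IsRes A z R then h.choose else 0

namespace IsSelfAdjointRegular

variable {A : E →ₗ.[ℂ] E} (hA : IsSelfAdjointRegular B A)
include hA

theorem isRes {z : ℂ} (hz : z.im ≠ 0) : IsRes A z (res A z) := by
  obtain ⟨R, hR, -⟩ := hA.selfAdjoint.exists_isRes hz (hA.shiftSurj hz)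
  have h : ∃ R, IsRes A z R := ⟨R, hR⟩
  rw [res, dif_pos h]
  exact h.choose_spec

theorem res_mem {z : ℂ} (hz : z.im ≠ 0) (y : E) : (res A z y, y - z • res A z y) ∈ A.graph :=
  (hA.isRes hz).mem_graph y

theorem res_add {z : ℂ} (hz : z.im ≠ 0) {x u : E} (h : (x, u) ∈ A.graph) :
    res A z (u + z • x) = x :=
  (hA.isRes hz).apply_add x u h

theorem norm_smul_res_le {z : ℂ} (hz : z.im ≠ 0) (hz' : z.re = 0) (y : E) :
    ‖z‖ * ‖res A z y‖ ≤ ‖y‖ := by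
  simpa using hA.selfAdjoint.norm_smul_le (hA.res_mem hz y) hz'

theorem norm_sub_res_le {z : ℂ} (hz : z.im ≠ 0) (hz' : z.re = 0) (y : E) :
    ‖y - z • res A z y‖ ≤ ‖y‖ := by
  simpa using hA.selfAdjoint.norm_apply_le (hA.res_mem hz y) hz'

theorem inner_res {z : ℂ} (hz : z.im ≠ 0) (x y : E) :
    inner B (res A z x) y = inner B x (res A (star z) y) := by
  have hz' : (star z).im ≠ 0 := by simpa using hz
  have h := hA.selfAdjoint.symm (hA.res_mem hz x) (hA.res_mem hz' y)
  simp only [CStarModule.inner_sub_left, CStarModule.inner_sub_right, CStarModule.inner_smul_left_complex,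
    CStarModule.inner_smul_right_complex] at h
  rw [sub_left_inj] at h
  exact h.symm

theorem isAdjointable_res {z : ℂ} (hz : z.im ≠ 0) : IsAdjointable B (res A z) :=
  ⟨res A (star z), hA.inner_res hz⟩

theorem isAdjointableInverse_res {z : ℂ} (hz : z.im ≠ 0) :
    IsAdjointableInverse B (shift A z) (res A z) where
  adjointable := hA.isAdjointable_res hz
  left_inv x := by
    rw [shift_apply_domain, add_comm]
    exact hA.res_add hz (mem_graph_of_mem (A := A) x.2)
  right_inv y := mem_graph_shift.2 (hA.res_mem hz y)

/-- `z (A + z)⁻¹ → 1` strongly as `z → ∞` along the imaginary axis. -/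
theorem tendsto_smul_res {ι : Type*} {F : Filter ι} {z : ι → ℂ} (hre : ∀ i, (z i).re = 0)
    (hz : Tendsto (fun i => ‖z i‖) F atTop) (x : E) :
    Tendsto (fun i => z i • res A (z i) x) F (𝓝 x) := by
  have him : ∀ i, 0 < ‖z i‖ → (z i).im ≠ 0 := fun i hi h =>
    (norm_pos_iff.1 hi) (Complex.ext (hre i) h)
  rw [Metric.tendsto_nhds]
  intro ε hε
  obtain ⟨w, hw, hwx⟩ := Metric.mem_closure_iff.1 (hA.selfAdjoint.dense_domain x) (ε / 3)
    (by positivity)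
  have hg := mem_graph_of_mem hw
  set v := A ⟨w, hw⟩ with hv
  filter_upwards [hz.eventually_gt_atTop 0, hz.eventually_gt_atTop (3 * ‖v‖ / ε)] with i h0 h1
  have hi := him i h0
  rw [dist_comm, dist_eq_norm]
  -- On `D(A)` the error is `(A+z)⁻¹A w = O(1/|z|)`; density suffices because `1 - z(A+z)⁻¹` is a
  -- contraction.
  have e1 : w - z i • res A (z i) w = res A (z i) v := by
    have := hA.res_add hi hg
    rw [map_add, map_smul] at this
    exact sub_eq_iff_eq_add.2 this.symm
  have e2 : x - z i • res A (z i) x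
      = ((x - w) - z i • res A (z i) (x - w)) + res A (z i) v := by
    rw [← e1, map_sub, smul_sub]; abel
  have h2 := hA.norm_sub_res_le hi (hre i) (x - w)
  have h3 := hA.norm_smul_res_le hi (hre i) v
  have h4 : ‖res A (z i) v‖ < ε / 3 := by
    have : 3 * ‖v‖ < ‖z i‖ * ε := by rwa [div_lt_iff₀ hε] at h1
    by_contra hcon
    push Not at hcon
    have := mul_le_mul_of_nonneg_left hcon h0.le
    linarith
  rw [dist_eq_norm] at hwx
  calc _ ≤ ‖(x - w) - z i • res A (z i) (x - w)‖ + ‖res A (z i) v‖ := by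
        rw [e2]; exact norm_add_le _ _
    _ < ε := by linarith

end IsSelfAdjointRegular

end Resolvent

/-! ### Elements of `F(S,T)` described by graphs. -/

section DomF

variable {E : Type*} [NormedAddCommGroup E] [NormedSpace ℂ E]

theorem mem_domF_iff {S T : E →ₗ.[ℂ] E} {x : E} :
    x ∈ domF S T ↔ ∃ u v p q, (x, u) ∈ S.graph ∧ (x, v) ∈ T.graph ∧ (u, p) ∈ T.graph ∧
      (v, q) ∈ S.graph := by
  constructor
  · rintro ⟨hS, hT, h1, h2⟩
    exact ⟨_, _, _, _, mem_graph_of_mem hS, mem_graph_of_mem hT, mem_graph_of_mem h1,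
      mem_graph_of_mem h2⟩
  · rintro ⟨u, v, p, q, hu, hv, hp, hq⟩
    refine ⟨S.mem_domain_of_mem_graph hu, T.mem_domain_of_mem_graph hv, ?_, ?_⟩
    · rw [apply_eq_of_mem_graph hu]; exact T.mem_domain_of_mem_graph hp
    · rw [apply_eq_of_mem_graph hv]; exact S.mem_domain_of_mem_graph hq

theorem domF_comm (S T : E →ₗ.[ℂ] E) : domF S T = domF T S := by
  ext x
  simp only [mem_domF_iff]
  constructor <;>
  · rintro ⟨u, v, p, q, h1, h2, h3, h4⟩
    exact ⟨v, u, q, p, h2, h1, h4, h3⟩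

variable {S T : E →ₗ.[ℂ] E} {x u v p q : E} (hx : x ∈ domF S T)

theorem resS_eq (hu : (x, u) ∈ S.graph) : resS S T ⟨x, hx⟩ = u :=
  apply_eq_of_mem_graph hu hx.1

theorem resT_eq (hv : (x, v) ∈ T.graph) : resT S T ⟨x, hx⟩ = v :=
  apply_eq_of_mem_graph hv hx.2.1

theorem prodST_eq (hv : (x, v) ∈ T.graph) (hq : (v, q) ∈ S.graph) :
    prodST S T ⟨x, hx⟩ = q := by
  have h := resT_eq hx hv
  subst h
  exact apply_eq_of_mem_graph hq hx.2.2.2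

theorem prodTS_eq (hu : (x, u) ∈ S.graph) (hp : (u, p) ∈ T.graph) :
    prodTS S T ⟨x, hx⟩ = p := by
  have h := resS_eq hx hu
  subst h
  exact apply_eq_of_mem_graph hp hx.2.2.1

theorem anticomm_eq (hu : (x, u) ∈ S.graph) (hv : (x, v) ∈ T.graph)
    (hp : (u, p) ∈ T.graph) (hq : (v, q) ∈ S.graph) :
    anticomm S T ⟨x, hx⟩ = p + q := by
  rw [anticomm, LinearMap.add_apply, prodST_eq hx hv hq, prodTS_eq hx hu hp, add_comm]

theorem im_ne_zero_of_re_eq_zero {l : ℂ} (h : l.re = 0) (h' : 0 < ‖l‖) : l.im ≠ 0 := fun h0 =>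
  norm_pos_iff.1 h' (Complex.ext h h0)

end DomF

/-! ### Norm form of weak anticommutation and the exchange of `S` and `T`. -/

section WeakAnti

variable {B : Type*} [NonUnitalCStarAlgebra B] [PartialOrder B] [StarOrderedRing B]
  {E : Type*} [NormedAddCommGroup E] [NormedSpace ℂ E] [CompleteSpace E]
  [SMul B E] [CStarModule B E]

/-- The norm estimate `‖[S,T] x‖ ≤ c (‖x‖ + ‖S x‖ + ‖T x‖)`. -/
def AnticommBound (S T : E →ₗ.[ℂ] E) (c : ℝ) : Prop :=
  ∀ x u v p q, (x, u) ∈ S.graph → (x, v) ∈ T.graph → (u, p) ∈ T.graph → (v, q) ∈ S.graph →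
    ‖p + q‖ ≤ c * (‖x‖ + ‖u‖ + ‖v‖)

variable (B) in
/-- A weakly anticommuting pair, with norm bounds and explicit constants, in which the resolvent of
`S` maps all of `D(T)` to `F(S,T)`. -/
structure AnticommPair (S T : E →ₗ.[ℂ] E) (c M : ℝ) : Prop where
  left : IsSelfAdjointRegular B S
  right : IsSelfAdjointRegular B T
  pos : 0 < c
  le : 12 * c + 1 ≤ M
  bound : AnticommBound S T c
  res_mem_domF : ∀ l : ℂ, l.re = 0 → M ≤ ‖l‖ → ∀ x t, (x, t) ∈ T.graph →
    res S l x ∈ domF S T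

-- Write `(S-l)Tx = [S,T]x - T(S+l)x` and use `|l|‖Tx‖ ≤ ‖(S-l)Tx‖`. The term `c‖Tx‖` from the
-- anticommutator is absorbed on the left because `|l| > 12c`. Thus `T(S+l)⁻¹` is controlled by the
-- graph norm of `T`.
omit [CompleteSpace E] in
theorem norm_apply_le_of_anticommBound {S T : E →ₗ.[ℂ] E} (hS : IsSelfAdjointOp B S) {c : ℝ}
    (hc : 0 < c) (hb : AnticommBound S T c) {l : ℂ} (hl : l.re = 0) (hl' : 12 * c + 1 ≤ ‖l‖)
    {x u v p q : E} (hu : (x, u) ∈ S.graph) (hv : (x, v) ∈ T.graph) (hp : (u, p) ∈ T.graph)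
    (hq : (v, q) ∈ S.graph) :
    ‖l‖ * ‖v‖ ≤ 2 * (2 * c * ‖u + l • x‖ + ‖p + l • v‖) := by
  have h1 := hS.norm_smul_le hq (z := -l) (by simpa using hl)
  have e : q + -l • v = (p + q) - (p + l • v) := by module
  rw [e, norm_neg] at h1
  have h2 := norm_sub_le (p + q) (p + l • v)
  have h3 := hb x u v p q hu hv hp hq
  have h4 := hS.norm_apply_le hu hl
  have h5 := hS.norm_smul_le hu hl
  have h6 : ‖x‖ ≤ ‖u + l • x‖ := le_trans (le_mul_of_one_le_left (norm_nonneg _) (by linarith)) h5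
  have h7 : c * (‖x‖ + ‖u‖ + ‖v‖) ≤ c * (‖u + l • x‖ + ‖u + l • x‖ + ‖v‖) := by gcongr
  have h8 : 12 * c * ‖v‖ ≤ ‖l‖ * ‖v‖ := by
    apply mul_le_mul_of_nonneg_right _ (norm_nonneg _); linarith
  have h9 : 0 ≤ c * ‖v‖ := by positivity
  nlinarith

/-- If the resolvent of `S` maps a core of `T` to `F(S,T)`, then it maps `D(T)` to `F(S,T)`. -/
theorem res_mem_domF_of_core {S T : E →ₗ.[ℂ] E} (hS : IsSelfAdjointRegular B S)
    (hT : IsSelfAdjointRegular B T) {c : ℝ} (hc : 0 < c) (hb : AnticommBound S T c)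
    {D : Submodule ℂ E} (hD : T.HasCore D) {l : ℂ} (hl : l.re = 0) (hl' : 12 * c + 1 ≤ ‖l‖)
    (h : ∀ x ∈ D, res S l x ∈ domF S T) {x t : E} (hx : (x, t) ∈ T.graph) :
    res S l x ∈ domF S T := by
  have him : l.im ≠ 0 := im_ne_zero_of_re_eq_zero hl (by linarith)
  let R := res S l
  -- Pairs `((x, Tx), (v, STRx))` with `v = TRx`. Bounding the second component by the first makes
  -- the domain closed in the graph of `T`; it contains the part of the graph over the core, hence
  -- everything.
  let Γ : Submodule ℂ ((E × E) × (E × E)) :=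
    T.graph.comap (ContinuousLinearMap.fst ℂ (E × E) (E × E)).toLinearMap ⊓
    T.graph.comap ((R.comp ((ContinuousLinearMap.fst ℂ E E).comp
      (ContinuousLinearMap.fst ℂ (E × E) (E × E)))).prod
        ((ContinuousLinearMap.fst ℂ E E).comp
          (ContinuousLinearMap.snd ℂ (E × E) (E × E)))).toLinearMap ⊓
    S.graph.comap (ContinuousLinearMap.snd ℂ (E × E) (E × E)).toLinearMap
  have hΓ : ∀ x t v q, ((x, t), (v, q)) ∈ Γ ↔ ((x, t) ∈ T.graph ∧ (R x, v) ∈ T.graph) ∧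
      (v, q) ∈ S.graph := fun _ _ _ _ => Iff.rfl
  have hcl : IsClosed (Γ : Set ((E × E) × (E × E))) :=
    ((hT.selfAdjoint.isClosed.preimage (ContinuousLinearMap.continuous _)).inter
      (hT.selfAdjoint.isClosed.preimage (ContinuousLinearMap.continuous _))).inter
      (hS.selfAdjoint.isClosed.preimage (ContinuousLinearMap.continuous _))
  have hsub : ∀ {x t v : E}, (x, t) ∈ T.graph → (R x, v) ∈ T.graph →
      (x - l • R x, t - l • v) ∈ T.graph := fun h1 h2 =>
    T.graph.sub_mem h1 (T.graph.smul_mem l h2)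
  have himg := isClosed_image_fst Γ hcl
    (2 * (2 * c + 1) + c * (2 + 2 * (2 * c + 1)) + 1 + 2 * (2 * c + 1)) (by
      rintro ⟨⟨x, t⟩, ⟨v, q⟩⟩ hm
      obtain ⟨⟨h1, h2⟩, h3⟩ := (hΓ x t v q).1 hm
      have h4 := hsub h1 h2
      have h5 := hS.res_mem him x
      have h6 := norm_apply_le_of_anticommBound hS.selfAdjoint hc hb hl hl' h5 h2 h4 h3
      have h7 := hb _ _ _ _ _ h5 h2 h4 h3
      have h8 := hS.norm_sub_res_le him hl x
      have h9 := hS.norm_smul_res_le him hl x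
      rw [sub_add_cancel, sub_add_cancel] at h6
      set N := ‖(x, t)‖ with hN
      have hx : ‖x‖ ≤ N := le_max_left _ _
      have ht : ‖t‖ ≤ N := le_max_right _ _
      have hN0 : 0 ≤ N := norm_nonneg _
      have h10 : ‖res S l x‖ ≤ N :=
        (le_mul_of_one_le_left (norm_nonneg _) (by linarith)).trans (h9.trans hx)
      have h6' : ‖l‖ * ‖v‖ ≤ 2 * (2 * c + 1) * N := by
        have : c * ‖x‖ ≤ c * N := by gcongr
        linarith
      have hv : ‖v‖ ≤ 2 * (2 * c + 1) * N :=
        (le_mul_of_one_le_left (norm_nonneg _) (by linarith)).trans h6'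
      have e : q = ((t - l • v + q) - t) + l • v := by abel
      have hq : ‖q‖ ≤ ‖t - l • v + q‖ + ‖t‖ + ‖l‖ * ‖v‖ := by
        calc ‖q‖ = ‖((t - l • v + q) - t) + l • v‖ := by rw [← e]
          _ ≤ _ := by
            rw [← norm_smul]
            exact (norm_add_le _ _).trans (by gcongr; exact norm_sub_le _ _)
      have h11 : c * (‖res S l x‖ + ‖x - l • res S l x‖ + ‖v‖) ≤
          c * (N + N + 2 * (2 * c + 1) * N) := by
        gcongr; exact h8.trans hx
      have h12 : 0 ≤ c * N := by positivity
      have h13 : 0 ≤ c * (c * N) := by positivity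
      change max ‖v‖ ‖q‖ ≤ _ * N
      apply max_le <;> nlinarith)
  have hmem : (x, t) ∈ Prod.fst '' (Γ : Set ((E × E) × (E × E))) := by
    refine closure_minimal ?_ himg (((hasCore_iff hT.selfAdjoint.isClosed).1 hD).2 x t hx)
    rintro ⟨y, s⟩ ⟨hy, hys⟩
    obtain ⟨u, v, p, q, h1, h2, h3, h4⟩ := mem_domF_iff.1 (h y hy)
    exact ⟨((y, s), (v, q)), (hΓ _ _ _ _).2 ⟨⟨hys, h2⟩, h4⟩, rfl⟩
  obtain ⟨⟨⟨x', t'⟩, ⟨v, q⟩⟩, hm, he⟩ := hmem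
  simp only [Prod.mk.injEq] at he
  obtain ⟨rfl, rfl⟩ := he
  obtain ⟨⟨h1, h2⟩, h3⟩ := (hΓ _ _ _ _).1 hm
  exact mem_domF_iff.2 ⟨_, v, _, q, hS.res_mem him x', h2, hsub h1 h2, h3⟩

namespace AnticommPair

variable {S T : E →ₗ.[ℂ] E} {c M : ℝ} (h : AnticommPair B S T c M)
include h

omit [StarOrderedRing B] [CompleteSpace E] in
theorem im_ne_zero {l : ℂ} (hl : l.re = 0) (hl' : M ≤ ‖l‖) : l.im ≠ 0 :=
  im_ne_zero_of_re_eq_zero hl (by linarith [h.pos, h.le])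

/-- The values of `S`, `T` and their products at `(S + l)⁻¹ x`, for `x ∈ D(T)`. -/
theorem exists_graph_res {l : ℂ} (hl : l.re = 0) (hl' : M ≤ ‖l‖) {x t : E}
    (hx : (x, t) ∈ T.graph) : ∃ v q, (res S l x, x - l • res S l x) ∈ S.graph ∧
      (res S l x, v) ∈ T.graph ∧ (x - l • res S l x, t - l • v) ∈ T.graph ∧ (v, q) ∈ S.graph ∧
      ‖l‖ * ‖v‖ ≤ 2 * (2 * c * ‖x‖ + ‖t‖) ∧
      ‖t - l • v + q‖ ≤ c * (‖res S l x‖ + ‖x - l • res S l x‖ + ‖v‖) := by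
  obtain ⟨u, v, p, q, h1, h2, h3, h4⟩ := mem_domF_iff.1 (h.res_mem_domF l hl hl' x t hx)
  have h5 := h.left.res_mem (h.im_ne_zero hl hl') x
  have h6 : (x - l • res S l x, t - l • v) ∈ T.graph :=
    T.graph.sub_mem hx (T.graph.smul_mem l h2)
  have h7 := norm_apply_le_of_anticommBound h.left.selfAdjoint h.pos h.bound hl
    (h.le.trans hl') h5 h2 h6 h4
  rw [sub_add_cancel, sub_add_cancel] at h7
  exact ⟨v, q, h5, h2, h6, h4, h7, h.bound _ _ _ _ _ h5 h2 h6 h4⟩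

/-- The operator `[S,T] (S + l)⁻¹ (T + m)⁻¹` is bounded and of norm less than `1`. -/
theorem exists_anticomm_res {l m : ℂ} (hl : l.re = 0) (hl' : M ≤ ‖l‖) (hm : m.re = 0)
    (hm' : M ≤ ‖m‖) : ∃ L : E →L[ℂ] E, ‖L‖ < 1 ∧
      ∀ y (hy : res S l (res T m y) ∈ domF S T), L y = anticomm S T ⟨_, hy⟩ := by
  have him := h.im_ne_zero hm hm'
  have hc := h.pos
  have hM := h.le
  have hmem : ∀ y, ((res S l).comp (res T m)).toLinearMap y ∈ domF S T := fun y =>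
    h.res_mem_domF l hl hl' _ _ (h.right.res_mem him y)
  let L₀ : E →ₗ[ℂ] E := (anticomm S T).comp
    ((((res S l).comp (res T m)).toLinearMap).codRestrict (domF S T) hmem)
  have hL₀ : ∀ y (hy : res S l (res T m y) ∈ domF S T), L₀ y = anticomm S T ⟨_, hy⟩ :=
    fun y hy => rfl
  -- With `b = ‖(T+m)⁻¹y‖` the image is at most `c(2b + ‖v‖)`, where `12cb ≤ ‖y‖` and `12c‖v‖ ≤ 4cb
  -- + 2‖y‖`.
  have hb : ∀ y, ‖L₀ y‖ ≤ (1 / 2 : ℝ) * ‖y‖ := by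
    intro y
    have hy : res S l (res T m y) ∈ domF S T := hmem y
    rw [hL₀ y hy]
    obtain ⟨v, q, h1, h2, h3, h4, h5, h6⟩ := h.exists_graph_res hl hl' (h.right.res_mem him y)
    rw [anticomm_eq hy h1 h2 h3 h4]
    refine h6.trans ?_
    have i1 := h.right.norm_sub_res_le him hm y
    have i2 := h.right.norm_smul_res_le him hm y
    have i3 := h.left.norm_sub_res_le (h.im_ne_zero hl hl') hl (res T m y)
    have i4 := h.left.norm_smul_res_le (h.im_ne_zero hl hl') hl (res T m y)
    set a := ‖res S l (res T m y)‖
    set b := ‖res T m y‖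
    set d := ‖res T m y - l • res S l (res T m y)‖
    have hM0 : 0 < M := by linarith
    have j1 : M * b ≤ ‖y‖ := (mul_le_mul_of_nonneg_right hm' (norm_nonneg _)).trans i2
    have j2 : M * a ≤ b := (mul_le_mul_of_nonneg_right hl' (norm_nonneg _)).trans i4
    have j3 : M * ‖v‖ ≤ 2 * (2 * c * b + ‖y‖) :=
      (mul_le_mul_of_nonneg_right hl' (norm_nonneg _)).trans (h5.trans (by linarith))
    have ha : a ≤ b := le_trans (le_mul_of_one_le_left (norm_nonneg _) (by linarith)) j2
    have hb0 : 0 ≤ b := norm_nonneg _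
    have j4 : 12 * c * b ≤ ‖y‖ := (mul_le_mul_of_nonneg_right (by linarith) hb0).trans j1
    have j5 : 12 * c * ‖v‖ ≤ 2 * (2 * c * b + ‖y‖) :=
      (mul_le_mul_of_nonneg_right (by linarith) (norm_nonneg _)).trans j3
    have j6 : c * (a + d + ‖v‖) ≤ c * (b + b + ‖v‖) := by gcongr
    nlinarith
  exact ⟨L₀.mkContinuous _ hb,
    (L₀.mkContinuous_norm_le (by norm_num) hb).trans_lt (by norm_num), hL₀⟩

/-- The resolvent of `T` maps `D(S)` to `F(S,T)`. -/
theorem res_right_mem_domF {m : ℂ} (hm : m.re = 0) (hm' : M ≤ ‖m‖) {y s : E}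
    (hy : (y, s) ∈ S.graph) : res T m y ∈ domF S T := by
  have hc := h.pos
  have hM := h.le
  have hnm : (-m).re = 0 := by simpa using hm
  have hnm' : M ≤ ‖-m‖ := by rwa [norm_neg]
  have him := h.im_ne_zero hm hm'
  have himn := h.im_ne_zero hnm hnm'
  obtain ⟨L, hL, hLa⟩ := h.exists_anticomm_res hm hm' hnm hnm'
  set x := res T m y with hx
  have hxT : (x, y - m • x) ∈ T.graph := h.right.res_mem him y
  have hxF : res S m x ∈ domF S T := h.res_mem_domF m hm hm' _ _ hxT
  -- If `x` were known to lie in `F`, then `w = (T-m)Sx` would solve this equation and `z` below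
  -- would be `Sx`. Solving it anyway gives a candidate `x' ∈ F` with `(S+m)x' = z + mx`, to be
  -- compared with `x`.
  obtain ⟨w, hw⟩ := exists_sub_eq_of_norm_lt_one hL (m • anticomm S T ⟨_, hxF⟩ - s)
  set z := res T (-m) w with hz
  have hzT : (z, w - -m • z) ∈ T.graph := h.right.res_mem himn w
  have hzF : res S m z ∈ domF S T := h.res_mem_domF m hm hm' _ _ hzT
  have hzx : (z + m • x, (w - -m • z) + m • (y - m • x)) ∈ T.graph :=
    T.graph.add_mem hzT (T.graph.smul_mem m hxT)
  obtain ⟨v, q, k1, k2, k3, k4, -, -⟩ := h.exists_graph_res hm hm' hzx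
  set x' := res S m (z + m • x) with hx'
  have hx'F : x' ∈ domF S T := h.res_mem_domF m hm hm' _ _ hzx
  have hG : anticomm S T ⟨x', hx'F⟩ = w + s := by
    have : (⟨x', hx'F⟩ : domF S T) = ⟨_, hzF⟩ + m • ⟨_, hxF⟩ := by
      apply Subtype.ext
      simp [hx']
    rw [this, map_add, map_smul, ← hLa w hzF]
    have h1 : m • anticomm S T ⟨_, hxF⟩ = w - L w + s := by rw [hw]; abel
    rw [h1]; abel
  rw [anticomm_eq hx'F k1 k2 k3 k4] at hG
  have hqe : q = w + s - ((w - -m • z) + m • (y - m • x) - m • v) := by rw [← hG]; abel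
  -- `d = x' - x` and `e = (T + m) d`
  have hdT : (x' - x, v - (y - m • x)) ∈ T.graph := T.graph.sub_mem k2 hxT
  set d := x' - x with hd
  set e := v - (y - m • x) + m • d with he
  -- The choice of `w` amounts to `S(T+m)d = m(T-m)d`.
  have heS : (e, m • (v - (y - m • x) - m • d)) ∈ S.graph := by
    have := S.graph.sub_mem (S.graph.add_mem k4 (S.graph.smul_mem m k1)) hy
    have e1 : e = v + m • x' - y := by simp only [he, hd]; module
    have e2 : m • (v - (y - m • x) - m • d) = q + m • (z + m • x - m • x') - s := by
      simp only [hd, hqe]; module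
    rw [e1, e2]
    exact this
  set f₀ := v - (y - m • x) - m • d with hf₀
  -- `(S-m)e = -2m²d` with `d ∈ D(T)`, so `e` is in the range of `(S-m)⁻¹` on `D(T)`.
  have heF : e ∈ domF S T := by
    have h1 := h.res_mem_domF (-m) hnm hnm' _ _ (T.graph.smul_mem (-2 * m * m) hdT)
    have h2 := h.left.res_add himn heS
    have h3 : m • f₀ + -m • e = (-2 * m * m) • d := by
      simp only [hf₀, he]; module
    rw [h3] at h2
    rwa [h2] at h1
  obtain ⟨u, ve, pe, qe, a1, a2, a3, a4⟩ := mem_domF_iff.1 heF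
  have hu : u = m • f₀ := S.mem_graph_snd_inj a1 heS rfl
  have hup : u = m • e + (-2 * m * m) • d := by rw [hu]; simp only [hf₀, he]; module
  have hpe : pe = m • ve + (-2 * m * m) • (v - (y - m • x)) := by
    refine T.mem_graph_snd_inj a3 (T.graph.add_mem (T.graph.smul_mem m a2)
      (T.graph.smul_mem (-2 * m * m) hdT)) ?_
    simpa using hup
  have hGe := h.bound _ _ _ _ _ a1 a2 a3 a4
  have hfS : (ve - m • e, qe - m • u) ∈ S.graph := S.graph.sub_mem a4 (S.graph.smul_mem m a1)
  -- That is, `[S,T]e = (S+m)(T-m)e`: a second-order expression equals a first-order one, which for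
  -- large `m` forces `e = 0`.
  have hGe' : pe + qe = (qe - m • u) + m • (ve - m • e) := by
    rw [hpe, hup, he]; module
  set f := ve - m • e with hf
  have b1 : ‖m‖ * ‖f‖ ≤ ‖pe + qe‖ := by
    rw [hGe']; exact h.left.selfAdjoint.norm_smul_le hfS hm
  have hfe : f = ve + -m • e := by rw [hf]; module
  have b2 : ‖ve‖ ≤ ‖f‖ := by
    rw [hfe]; exact h.right.selfAdjoint.norm_apply_le a2 hnm
  have b3 : ‖m‖ * ‖e‖ ≤ ‖f‖ := by
    have := h.right.selfAdjoint.norm_smul_le a2 hnm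
    rwa [← hfe, norm_neg] at this
  -- `T` is symmetric and `m` imaginary, so `(T-m)d` and `(T+m)d` have the same square; hence `‖Se‖
  -- = |m|‖f₀‖ ≤ |m|‖e‖ ≤ ‖f‖`.
  have b4 : ‖f₀‖ ≤ ‖e‖ := by
    refine norm_le_of_inner_le B (le_of_eq ?_)
    have e1 := inner_add_smul_self_of_re_eq_zero B (h.right.selfAdjoint.symm hdT hdT) hm
    have e2 := inner_add_smul_self_of_re_eq_zero B (h.right.selfAdjoint.symm hdT hdT) hnm
    rw [← he] at e1
    have : v - (y - m • x) + -m • d = f₀ := by rw [hf₀]; module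
    rw [this] at e2
    rw [e1, e2]
    simp
  have b5 : ‖u‖ ≤ ‖f‖ := by
    rw [hu, norm_smul]
    exact (mul_le_mul_of_nonneg_left b4 (norm_nonneg _)).trans b3
  have b6 : ‖e‖ ≤ ‖f‖ :=
    (le_mul_of_one_le_left (norm_nonneg _) (by linarith)).trans b3
  have hf0 : ‖f‖ ≤ 0 := by
    have : c * (‖e‖ + ‖u‖ + ‖ve‖) ≤ c * (‖f‖ + ‖f‖ + ‖f‖) := by gcongr
    have h1 : ‖m‖ * ‖f‖ ≤ 3 * c * ‖f‖ := by linarith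
    have h2 : (12 * c + 1) * ‖f‖ ≤ ‖m‖ * ‖f‖ :=
      mul_le_mul_of_nonneg_right (by linarith) (norm_nonneg _)
    have h3 : 0 ≤ c * ‖f‖ := by positivity
    linarith
  have he0 : e = 0 := norm_le_zero_iff.1 (b6.trans hf0)
  have hd0 : d = 0 := by
    have := h.right.res_add him hdT
    rw [← he, he0, map_zero] at this
    exact this.symm
  have : x = x' := (sub_eq_zero.1 hd0).symm
  rw [this]
  exact hx'F

/-- The constants `c` and `M` are unchanged, so every later result has its mirror image for free. -/
theorem symm : AnticommPair B T S c M where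
  left := h.right
  right := h.left
  pos := h.pos
  le := h.le
  bound := fun x u v p q h1 h2 h3 h4 => by
    have := h.bound x v u q p h2 h1 h4 h3
    rw [add_comm p q, add_right_comm]
    linarith
  res_mem_domF := fun l hl hl' x t hx => by
    rw [domF_comm]
    exact h.res_right_mem_domF hl hl' hx

end AnticommPair

end WeakAnti

/-! ### Approximation from `F` and the graph norm of the sum. -/

section FormBound

variable {B : Type*} [NonUnitalCStarAlgebra B] [PartialOrder B] [StarOrderedRing B]
  {E : Type*} [NormedAddCommGroup E] [NormedSpace ℂ E] [CompleteSpace E]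
  [SMul B E] [CStarModule B E]

variable (B) in
/-- The form estimate for the anticommutator, in terms of graphs. -/
def FormBound (S T : E →ₗ.[ℂ] E) (C₀ C₁ C₂ : ℝ) : Prop :=
  ∀ x u v p q, (x, u) ∈ S.graph → (x, v) ∈ T.graph → (u, p) ∈ T.graph → (v, q) ∈ S.graph →
    inner B (p + q) (p + q) ≤ C₀ • inner B x x + C₁ • inner B u u + C₂ • inner B v v

omit [CompleteSpace E] in
theorem FormBound.anticommBound {S T : E →ₗ.[ℂ] E} {C₀ C₁ C₂ : ℝ} (h : FormBound B S T C₀ C₁ C₂)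
    (h₀ : 0 < C₀) (h₁ : 0 < C₁) (h₂ : 0 < C₂) : AnticommBound S T (C₀ + C₁ + C₂ + 1) := by
  intro x u v p q h1 h2 h3 h4
  have h5 := CStarAlgebra.norm_le_norm_of_nonneg_of_le CStarModule.inner_self_nonneg
    (h x u v p q h1 h2 h3 h4)
  have h6 : ‖C₀ • inner B x x + C₁ • inner B u u + C₂ • inner B v v‖ ≤
      C₀ * ‖x‖ ^ 2 + C₁ * ‖u‖ ^ 2 + C₂ * ‖v‖ ^ 2 := by
    refine norm_add₃_le.trans (le_of_eq ?_)
    simp only [norm_smul, Real.norm_eq_abs, abs_of_pos h₀, abs_of_pos h₁, abs_of_pos h₂,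
      CStarModule.norm_sq_eq B]
  rw [← CStarModule.norm_sq_eq] at h5
  refine le_of_sq_le_sq ((h5.trans h6).trans ?_) (by positivity)
  set c := C₀ + C₁ + C₂ + 1
  have hc : 1 ≤ c := by linarith
  have hx := norm_nonneg x
  have hu := norm_nonneg u
  have hv := norm_nonneg v
  have e1 : C₀ * ‖x‖ ^ 2 + C₁ * ‖u‖ ^ 2 + C₂ * ‖v‖ ^ 2 ≤
      c * ‖x‖ ^ 2 + c * ‖u‖ ^ 2 + c * ‖v‖ ^ 2 := by
    gcongr <;> linarith
  have e2 : c * (‖x‖ ^ 2 + ‖u‖ ^ 2 + ‖v‖ ^ 2) ≤ c ^ 2 * (‖x‖ + ‖u‖ + ‖v‖) ^ 2 := by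
    gcongr
    · nlinarith
    · nlinarith [mul_nonneg hx hu, mul_nonneg hx hv, mul_nonneg hu hv]
  rw [mul_pow]
  linarith

omit [StarOrderedRing B] [CompleteSpace E] in
theorem IsWeaklyAnticommuting.exists_formBound {S T : E →ₗ.[ℂ] E}
    (h : IsWeaklyAnticommuting B S T) :
    ∃ C₀ C₁ C₂ : ℝ, 0 < C₀ ∧ 0 < C₁ ∧ 0 < C₂ ∧ FormBound B S T C₀ C₁ C₂ := by
  obtain ⟨C₀, C₁, C₂, h₀, h₁, h₂, hC⟩ := h.form_estimate
  refine ⟨C₀, C₁, C₂, h₀, h₁, h₂, fun x u v p q h1 h2 h3 h4 => ?_⟩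
  have hx : x ∈ domF S T := mem_domF_iff.2 ⟨u, v, p, q, h1, h2, h3, h4⟩
  have := hC ⟨x, hx⟩
  rwa [anticomm_eq hx h1 h2 h3 h4, resS_eq hx h1, resT_eq hx h2] at this

theorem IsWeaklyAnticommuting.exists_anticommPair {S T : E →ₗ.[ℂ] E}
    (h : IsWeaklyAnticommuting B S T) : ∃ c M, AnticommPair B S T c M := by
  obtain ⟨C₀, C₁, C₂, h₀, h₁, h₂, hC⟩ := h.exists_formBound
  obtain ⟨D, hD, l₀, hl₀, hl⟩ := h.core
  have hc : 0 < C₀ + C₁ + C₂ + 1 := by positivity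
  have hb := hC.anticommBound h₀ h₁ h₂
  refine ⟨C₀ + C₁ + C₂ + 1, max (12 * (C₀ + C₁ + C₂ + 1) + 1) l₀, h.left, h.right, hc,
    le_max_left _ _, hb, fun l hre hn x t hx => ?_⟩
  have hn1 := (le_max_left _ _).trans hn
  refine res_mem_domF_of_core h.left h.right hc hb hD hre hn1 (fun y hy => ?_) hx
  exact hl l hre ((le_max_right _ _).trans hn) ⟨y, hy, mem_graph_shift.2
    (h.left.res_mem (im_ne_zero_of_re_eq_zero hre (by linarith)) y)⟩

theorem IsSelfAdjointRegular.res_mem_graph_res {A : E →ₗ.[ℂ] E} (hA : IsSelfAdjointRegular B A)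
    {z : ℂ} (hz : z.im ≠ 0) {x s : E} (h : (x, s) ∈ A.graph) :
    x - z • res A z x = res A z s := by
  have := hA.res_add hz h
  rw [map_add, map_smul] at this
  rw [sub_eq_iff_eq_add]
  exact this.symm

namespace AnticommPair

variable {S T : E →ₗ.[ℂ] E} {c M : ℝ} (h : AnticommPair B S T c M)
include h

/-- Every `x ∈ D(T)` is approximated from `F(S,T)` in the graph norm of `T`, and simultaneously in
that of `S` if `x ∈ D(S)`. -/
theorem exists_tendsto_domF {x t : E} (hx : (x, t) ∈ T.graph) : ∃ u a b : ℕ → E,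
    (∀ᶠ n in atTop, u n ∈ domF S T ∧ (u n, a n) ∈ S.graph ∧ (u n, b n) ∈ T.graph) ∧
    Tendsto u atTop (𝓝 x) ∧ Tendsto b atTop (𝓝 t) ∧
    ∀ s, (x, s) ∈ S.graph → Tendsto a atTop (𝓝 s) := by
  -- The approximants are `l(S+l)⁻¹x`; bounds from `AnticommPair` hold only once `n ≥ M`, whence the
  -- dummy zeros chosen for small `n`.
  let l : ℕ → ℂ := fun n => n * Complex.I
  have hre : ∀ n, (l n).re = 0 := fun n => by simp [l]
  have hnl : ∀ n, ‖l n‖ = n := fun n => by simp [l]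
  have hlim : Tendsto (fun n => ‖l n‖) atTop atTop := by
    simp only [hnl]; exact tendsto_natCast_atTop_atTop
  have hre' : ∀ n, (-l n).re = 0 := fun n => by simp [l]
  have hlim' : Tendsto (fun n => ‖-l n‖) atTop atTop := by simpa only [norm_neg] using hlim
  have hev : ∀ᶠ n in atTop, M ≤ ‖l n‖ := hlim.eventually_ge_atTop M
  have hex : ∀ n, ∃ v q, M ≤ ‖l n‖ → (res S (l n) x, v) ∈ T.graph ∧ (v, q) ∈ S.graph ∧
      ‖l n‖ * ‖v‖ ≤ 2 * (2 * c * ‖x‖ + ‖t‖) ∧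
      ‖t - l n • v + q‖ ≤ c * (‖res S (l n) x‖ + ‖x - l n • res S (l n) x‖ + ‖v‖) := by
    intro n
    by_cases hn : M ≤ ‖l n‖
    · obtain ⟨v, q, -, h2, -, h4, h5, h6⟩ := h.exists_graph_res (hre n) hn hx
      exact ⟨v, q, fun _ => ⟨h2, h4, h5, h6⟩⟩
    · exact ⟨0, 0, fun h' => absurd h' hn⟩
  choose v q hvq using hex
  have hlx := h.left.tendsto_smul_res hre hlim x
  have hbd : ∀ (w : ℕ → E) (K : ℝ), (∀ᶠ n in atTop, ‖l n‖ * ‖w n‖ ≤ K) →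
      Tendsto (fun n => ‖w n‖) atTop (𝓝 0) := by
    intro w K hw
    have hK : Tendsto (fun n => K / ‖l n‖) atTop (𝓝 0) := hlim.const_div_atTop K
    refine squeeze_zero' (Eventually.of_forall fun n => norm_nonneg _) ?_ hK
    filter_upwards [hw, hlim.eventually_gt_atTop 0] with n hn hn0
    rwa [le_div_iff₀' hn0]
  have hv0 : Tendsto (fun n => ‖v n‖) atTop (𝓝 0) :=
    hbd v _ (hev.mono fun n hn => (hvq n hn).2.2.1)
  have hr0 : Tendsto (fun n => ‖res S (l n) x‖) atTop (𝓝 0) :=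
    hbd _ ‖x‖ (hev.mono fun n hn => h.left.norm_smul_res_le (h.im_ne_zero (hre n) hn) (hre n) x)
  have hs0 : Tendsto (fun n => ‖x - l n • res S (l n) x‖) atTop (𝓝 0) := by
    have := (tendsto_const_nhds (x := x)).sub hlx
    rw [sub_self] at this
    simpa using this.norm
  have hG : Tendsto (fun n => t - l n • v n + q n) atTop (𝓝 0) := by
    refine squeeze_zero_norm' (hev.mono fun n hn => (hvq n hn).2.2.2) ?_
    simpa using ((hr0.add hs0).add hv0).const_mul c
  refine ⟨fun n => l n • res S (l n) x, fun n => l n • (x - l n • res S (l n) x),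
    fun n => l n • v n, ?_, hlx, ?_, ?_⟩
  · filter_upwards [hev] with n hn
    exact ⟨(domF S T).smul_mem _ (h.res_mem_domF _ (hre n) hn _ _ hx),
      S.graph.smul_mem (l n) (h.left.res_mem (h.im_ne_zero (hre n) hn) x),
      T.graph.smul_mem (l n) (hvq n hn).1⟩
  -- With `G = [S,T](S+l)⁻¹x → 0`, the relation `(S-l)v = G - t` gives `lv = -l(S-l)⁻¹(t - G)`,
  -- which tends to `t`.
  · have h1 := h.left.tendsto_smul_res hre' hlim' t
    have h2 : Tendsto (fun n => -l n • res S (-l n) (t - l n • v n + q n)) atTop (𝓝 0) := by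
      refine squeeze_zero_norm' ?_ (by simpa using hG.norm)
      filter_upwards [hev] with n hn
      rw [norm_smul]
      exact h.left.norm_smul_res_le (h.im_ne_zero (hre' n) (by rwa [norm_neg])) (hre' n) _
    have h3 := h1.sub h2
    rw [sub_zero] at h3
    refine h3.congr' ?_
    filter_upwards [hev] with n hn
    have h4 := h.left.res_add (h.im_ne_zero (hre' n) (by rwa [norm_neg])) (hvq n hn).2.1
    rw [← smul_sub, ← map_sub]
    have h5 : t - (t - l n • v n + q n) = -(q n + -l n • v n) := by module
    rw [h5, map_neg, h4]
    module
  · intro s hs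
    refine (h.left.tendsto_smul_res hre hlim s).congr' ?_
    filter_upwards [hev] with n hn
    rw [h.left.res_mem_graph_res (h.im_ne_zero (hre n) hn) hs]

theorem hasCore_right : T.HasCore (domF S T) := by
  refine hasCore_of_tendsto h.right.selfAdjoint.isClosed (domF_le_right S T) fun x y hxy => ?_
  obtain ⟨u, a, b, h1, h2, h3, -⟩ := h.exists_tendsto_domF hxy
  exact ⟨u, b, h1.mono fun n hn => hn.1, h1.mono fun n hn => hn.2.2, h2, h3⟩

theorem hasCore_left : S.HasCore (domF S T) := by
  rw [domF_comm]
  exact h.symm.hasCore_right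

/-- The graph norm estimate for `S + T`. -/
theorem inner_add_le {C₀ C₁ C₂ : ℝ} (h₀ : 0 < C₀) (h₁ : 0 < C₁) (h₂ : 0 < C₂)
    (hC : FormBound B S T C₀ C₁ C₂) {x s t : E} (hs : (x, s) ∈ S.graph) (ht : (x, t) ∈ T.graph) :
    inner B x x + inner B s s + inner B t t ≤
      (2 + (C₀ + C₁ + C₂)) • (inner B x x + inner B (s + t) (s + t)) := by
  have key : ∀ x s t, x ∈ domF S T → (x, s) ∈ S.graph → (x, t) ∈ T.graph →
      inner B x x + inner B s s + inner B t t ≤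
        (2 + (C₀ + C₁ + C₂)) • (inner B x x + inner B (s + t) (s + t)) := by
    intro x s t hx hs ht
    obtain ⟨u, v, p, q, h1, h2, h3, h4⟩ := mem_domF_iff.1 hx
    obtain rfl : s = u := S.mem_graph_snd_inj hs h1 rfl
    obtain rfl : t = v := T.mem_graph_snd_inj ht h2 rfl
    have e1 : inner B (p + q) x = inner B s t + inner B t s := by
      rw [CStarModule.inner_add_left, h.right.selfAdjoint.symm h3 ht,
        h.left.selfAdjoint.symm h4 hs]
    have e2 : inner B x (p + q) = inner B s t + inner B t s := by
      rw [CStarModule.inner_add_right, ← h.right.selfAdjoint.symm ht h3,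
        ← h.left.selfAdjoint.symm hs h4, add_comm]
    have e3 := hC _ _ _ _ _ h1 h2 h3 h4
    set k := C₀ + C₁ + C₂ with hk
    have hk0 : 0 < k := by positivity
    have n1 : 0 ≤ inner B (s + t) (s + t) := CStarModule.inner_self_nonneg
    -- This square bounds `2k⟨x,[S,T]x⟩` from below. `n3`, `n4`, `n5` raise each constant of the
    -- form estimate to `k`; the claimed difference is then exactly the sum `n6` of positive
    -- elements.
    have n2 : 0 ≤ inner B ((p + q) + k • x) ((p + q) + k • x) := CStarModule.inner_self_nonneg
    have n3 : 0 ≤ (C₁ + C₂) • inner B x x :=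
      smul_nonneg (by positivity) CStarModule.inner_self_nonneg
    have n4 : 0 ≤ (C₀ + C₂) • inner B s s :=
      smul_nonneg (by positivity) CStarModule.inner_self_nonneg
    have n5 : 0 ≤ (C₀ + C₁) • inner B t t :=
      smul_nonneg (by positivity) CStarModule.inner_self_nonneg
    have n6 := add_nonneg (smul_nonneg hk0.le n1) (smul_nonneg (inv_nonneg.2 hk0.le)
      (add_nonneg (add_nonneg (add_nonneg (add_nonneg n2 n3) n4) n5) (sub_nonneg.2 e3)))
    rw [← sub_nonneg]
    refine n6.trans (le_of_eq ?_)
    generalize p + q = g at *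
    simp only [CStarModule.inner_add_left, CStarModule.inner_add_right,
      CStarModule.inner_smul_left_real, CStarModule.inner_smul_right_real, e1, e2]
    rw [hk] at hk0 ⊢
    match_scalars <;> field_simp <;> ring
  obtain ⟨u, a, b, h1, h2, h3, h4⟩ := h.exists_tendsto_domF ht
  have h4 := h4 s hs
  have hin : ∀ {f : ℕ → E} {y : E}, Tendsto f atTop (𝓝 y) →
      Tendsto (fun n => inner B (f n) (f n)) atTop (𝓝 (inner B y y)) := fun {f y} hf =>
    (CStarModule.continuous_inner (A := B) (E := E)).continuousAt.tendsto.comp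
      (hf.prodMk_nhds hf)
  refine le_of_tendsto_of_tendsto (((hin h2).add (hin h4)).add (hin h3))
    (((hin h2).add (hin (h4.add h3))).const_smul _) ?_
  filter_upwards [h1] with n hn
  exact key _ _ _ hn.1 hn.2.1 hn.2.2

end AnticommPair

omit [CompleteSpace E] in
theorem add_inner_le_smul {C : ℝ} (hC : 2 ≤ C) (x s t : E) :
    inner B x x + inner B (s + t) (s + t) ≤
      C • (inner B x x + inner B s s + inner B t t) := by
  have n1 : 0 ≤ inner B (s - t) (s - t) := CStarModule.inner_self_nonneg
  have n2 : 0 ≤ (C - 1) • inner B x x :=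
    smul_nonneg (by linarith) CStarModule.inner_self_nonneg
  have n3 : 0 ≤ (C - 2) • inner B s s :=
    smul_nonneg (by linarith) CStarModule.inner_self_nonneg
  have n4 : 0 ≤ (C - 2) • inner B t t :=
    smul_nonneg (by linarith) CStarModule.inner_self_nonneg
  rw [← sub_nonneg]
  refine (add_nonneg (add_nonneg (add_nonneg n1 n2) n3) n4).trans (le_of_eq ?_)
  simp only [CStarModule.inner_add_left, CStarModule.inner_add_right,
    CStarModule.inner_sub_left, CStarModule.inner_sub_right]
  module

omit [CompleteSpace E] in
theorem norm_le_of_inner_add_le {C : ℝ} (hC : 1 ≤ C) {x s t y : E}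
    (h : inner B x x + inner B s s + inner B t t ≤ C • (inner B x x + inner B y y)) :
    ‖s‖ ≤ C * (‖x‖ + ‖y‖) ∧ ‖t‖ ≤ C * (‖x‖ + ‖y‖) := by
  have nx : 0 ≤ inner B x x := CStarModule.inner_self_nonneg
  have ns : 0 ≤ inner B s s := CStarModule.inner_self_nonneg
  have nt : 0 ≤ inner B t t := CStarModule.inner_self_nonneg
  have key : ∀ w : E, inner B w w ≤ inner B x x + inner B s s + inner B t t →
      ‖w‖ ≤ C * (‖x‖ + ‖y‖) := by
    intro w hw
    have h1 := CStarAlgebra.norm_le_norm_of_nonneg_of_le CStarModule.inner_self_nonneg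
      (hw.trans h)
    have h2 : ‖C • (inner B x x + inner B y y)‖ ≤ C * (‖x‖ ^ 2 + ‖y‖ ^ 2) := by
      rw [norm_smul, Real.norm_eq_abs, abs_of_pos (by linarith), CStarModule.norm_sq_eq B,
        CStarModule.norm_sq_eq B]
      gcongr
      exact norm_add_le _ _
    rw [← CStarModule.norm_sq_eq] at h1
    refine le_of_sq_le_sq ((h1.trans h2).trans ?_) (by positivity)
    rw [mul_pow]
    gcongr
    · nlinarith
    · nlinarith [norm_nonneg x, norm_nonneg y, mul_nonneg (norm_nonneg x) (norm_nonneg y)]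
  refine ⟨key s ?_, key t ?_⟩
  · rw [add_right_comm]; exact le_add_of_nonneg_left (add_nonneg nx nt)
  · exact le_add_of_nonneg_left (add_nonneg nx ns)

end FormBound

/-! ### Stability of adjointability. -/

section Adjointable

variable {B : Type*} [NonUnitalCStarAlgebra B] [PartialOrder B] [StarOrderedRing B]
  {E : Type*} [NormedAddCommGroup E] [NormedSpace ℂ E] [SMul B E] [CStarModule B E]

omit [StarOrderedRing B] in
theorem IsAdjointable.comp {R R' : E →L[ℂ] E} (h : IsAdjointable B R) (h' : IsAdjointable B R') :
    IsAdjointable B (R.comp R') := by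
  obtain ⟨Q, hQ⟩ := h
  obtain ⟨Q', hQ'⟩ := h'
  exact ⟨Q'.comp Q, fun x y => by simp [hQ, hQ']⟩

omit [StarOrderedRing B] in
theorem IsAdjointable.smul {R : E →L[ℂ] E} (h : IsAdjointable B R) (z : ℂ) :
    IsAdjointable B (z • R) := by
  obtain ⟨Q, hQ⟩ := h
  refine ⟨star z • Q, fun x y => ?_⟩
  simp only [smul_apply, CStarModule.inner_smul_left_complex,
    CStarModule.inner_smul_right_complex, hQ]

theorem norm_le_of_adjoint {R Q : E →L[ℂ] E}
    (h : ∀ x y : E, inner B (R x) y = inner B x (Q y)) : ‖Q‖ ≤ ‖R‖ := by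
  refine Q.opNorm_le_bound (norm_nonneg _) fun y => ?_
  have h1 : ‖Q y‖ ^ 2 ≤ ‖R‖ * ‖Q y‖ * ‖y‖ := by
    rw [CStarModule.norm_sq_eq B, ← h]
    exact (CStarModule.norm_inner_le E).trans (by gcongr; exact R.le_opNorm _)
  rcases (norm_nonneg (Q y)).eq_or_lt with h0 | h0
  · rw [← h0]; positivity
  · nlinarith

/-- The adjoint is `(1-Q)⁻¹` with `Q` the adjoint of `L`; its Neumann series converges since `‖Q‖ ≤
‖L‖`. -/
theorem IsAdjointable.inv_oneSub [CompleteSpace E] {L : E →L[ℂ] E} (h : IsAdjointable B L)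
    (hL : ‖L‖ < 1) : IsAdjointable B (↑(Units.oneSub L hL)⁻¹ : E →L[ℂ] E) := by
  obtain ⟨Q, hQ⟩ := h
  have hQn : ‖Q‖ < 1 := (norm_le_of_adjoint hQ).trans_lt hL
  refine ⟨(↑(Units.oneSub Q hQn)⁻¹ : E →L[ℂ] E), fun x y => ?_⟩
  have h1 := congrArg (fun f : E →L[ℂ] E => f x) (Units.oneSub L hL).mul_inv
  have h2 := congrArg (fun f : E →L[ℂ] E => f y) (Units.oneSub Q hQn).mul_inv
  simp only [Units.val_oneSub, mul_apply_eq_comp, sub_apply,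
    one_apply_eq_self] at h1 h2
  set a := (↑(Units.oneSub L hL)⁻¹ : E →L[ℂ] E) x
  set b := (↑(Units.oneSub Q hQn)⁻¹ : E →L[ℂ] E) y
  rw [← h1, ← h2, CStarModule.inner_sub_right, CStarModule.inner_sub_left, hQ]

end Adjointable

/-! ### The parameters `l`. -/

section Param

/-- Here `m = rl` with `0 < r < 1`. The resulting `‖l - m‖ < ‖l‖` is what makes the Neumann series
for the approximating operator converge. -/
theorem exists_real_of_mem_paramSet {l m : ℂ} (hm : m.re = 0) (hl : l ∈ paramSet m) :
    ∃ r : ℝ, 0 < r ∧ m = r * l ∧ l ≠ 0 ∧ star l = -l ∧ ‖l - m‖ < ‖l‖ ∧ r = ‖m‖ / ‖l‖ := by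
  obtain ⟨h1, h2, h3⟩ := hl
  have hl0 : l ≠ 0 := norm_pos_iff.1 ((norm_nonneg m).trans_lt h2)
  have hli : l.im ≠ 0 := fun h => hl0 (Complex.ext h1 h)
  have hr : m = ((m / l).re : ℂ) * l := by
    have him : (m / l).im = 0 := by simp [Complex.div_im, h1, hm]
    have : ((m / l).re : ℂ) = m / l := Complex.ext rfl (by simp [him])
    rw [this, div_mul_cancel₀ _ hl0]
  have hl' : 0 < ‖l‖ := norm_pos_iff.2 hl0
  set r := (m / l).re
  have hn : ‖m‖ = r * ‖l‖ := by
    rw [hr, norm_mul, Complex.norm_real, Real.norm_eq_abs, abs_of_pos h3]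
  have hr1 : r < 1 := by
    rw [hn] at h2
    by_contra hcon
    push Not at hcon
    nlinarith
  refine ⟨r, h3, hr, hl0, Complex.ext (by simp [h1]) (by simp), ?_, ?_⟩
  · have : l - m = ((1 - r : ℝ) : ℂ) * l := by rw [hr]; push_cast; ring
    rw [this, norm_mul, Complex.norm_real, Real.norm_eq_abs, abs_of_pos (by linarith)]
    nlinarith
  · rw [hn, mul_div_cancel_right₀ _ hl'.ne']

end Param

/-! ### The square of the approximating operator. -/

section Approx

variable {E : Type*} [NormedAddCommGroup E] [NormedSpace ℂ E]

/-- `u ∈ F(S,T)` with `s = S u`, `t = T u`, `p = T S u`, `q = S T u`. -/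
structure DomFData (S T : E →ₗ.[ℂ] E) (u s t p q : E) : Prop where
  memS : (u, s) ∈ S.graph
  memT : (u, t) ∈ T.graph
  memTS : (s, p) ∈ T.graph
  memST : (t, q) ∈ S.graph

theorem DomFData.sub {S T : E →ₗ.[ℂ] E} {u s t p q u' s' t' p' q' : E}
    (h : DomFData S T u s t p q) (h' : DomFData S T u' s' t' p' q') :
    DomFData S T (u - u') (s - s') (t - t') (p - p') (q - q') :=
  ⟨S.graph.sub_mem h.memS h'.memS, T.graph.sub_mem h.memT h'.memT,
    T.graph.sub_mem h.memTS h'.memTS, S.graph.sub_mem h.memST h'.memST⟩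

theorem mem_graph_approxOp {S T : E →ₗ.[ℂ] E} {l m : ℂ} {u y : E} :
    (u, y) ∈ (approxOp S T l m).graph ↔
      ∃ s t p q, DomFData S T u s t p q ∧ s + t + l⁻¹ • p + m • u = y := by
  have key : ∀ (hu : u ∈ domF S T) {s t p q}, DomFData S T u s t p q →
      approxOp S T l m ⟨u, hu⟩ = s + t + l⁻¹ • p + m • u := by
    intro hu s t p q hd
    change resS S T ⟨u, hu⟩ + resT S T ⟨u, hu⟩ + l⁻¹ • prodTS S T ⟨u, hu⟩ + m • u = _
    rw [resS_eq hu hd.memS, resT_eq hu hd.memT, prodTS_eq hu hd.memS hd.memTS]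
  constructor
  · intro h
    obtain ⟨⟨w, hw⟩, rfl, rfl⟩ := (LinearPMap.mem_graph_iff _).1 h
    obtain ⟨s, t, p, q, h1, h2, h3, h4⟩ := mem_domF_iff.1 hw
    exact ⟨s, t, p, q, ⟨h1, h2, h3, h4⟩, (key hw ⟨h1, h2, h3, h4⟩).symm⟩
  · rintro ⟨s, t, p, q, hd, rfl⟩
    have hu : u ∈ domF S T := mem_domF_iff.2 ⟨s, t, p, q, hd.memS, hd.memT, hd.memTS, hd.memST⟩
    exact (LinearPMap.mem_graph_iff _).2 ⟨⟨u, hu⟩, rfl, key hu hd⟩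

variable {B : Type*} [NonUnitalCStarAlgebra B] [PartialOrder B] [StarOrderedRing B]
  [SMul B E] [CStarModule B E]

-- Because `l` and `m` are imaginary with positive ratio, four squares appear and every mixed term
-- collapses to a pairing with `[S,T]u = p + q`.
omit [StarOrderedRing B] in
theorem inner_approx_self {S T : E →ₗ.[ℂ] E} (hS : IsSelfAdjointOp B S) (hT : IsSelfAdjointOp B T)
    {l m : ℂ} {r : ℝ} (hm : m = r * l) (hl : l ≠ 0) (hl' : star l = -l) {u s t p q : E}
    (h : DomFData S T u s t p q) :
    inner B (s + t + l⁻¹ • p + m • u) (s + t + l⁻¹ • p + m • u) =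
      inner B s s + inner B t t + inner B (m • u) (m • u) + inner B (l⁻¹ • p) (l⁻¹ • p)
      + ((1 - r : ℝ) : ℂ) • inner B u (p + q)
      + l⁻¹ • (inner B t (p + q) - inner B (p + q) t) := by
  have e1 := hS.symm h.memS h.memS
  have e2 := hT.symm h.memT h.memT
  have e3 := hT.symm h.memTS h.memT
  have e4 := hT.symm h.memT h.memTS
  have e5 := hS.symm h.memS h.memST
  have e6 := hT.symm h.memTS h.memTS
  have e7 := hS.symm h.memST h.memST
  have hlm : star m = -m := by simp [hm] at hl' ⊢; rw [hl']; ring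
  have hli : star (l⁻¹) = -l⁻¹ := by rw [star_inv₀, hl', inv_neg]
  simp only [CStarModule.inner_add_left, CStarModule.inner_add_right,
    CStarModule.inner_smul_left_complex, CStarModule.inner_smul_right_complex, hlm, hli,
    e1, e2, e3, e4, e5, e6, e7]
  rw [hm]
  match_scalars <;> field_simp <;> ring

end Approx

/-! ### Inverting the approximating operator, uniformly in `l`. -/

section Sum

variable {B : Type*} [NonUnitalCStarAlgebra B] [PartialOrder B] [StarOrderedRing B]
  {E : Type*} [NormedAddCommGroup E] [NormedSpace ℂ E] [CompleteSpace E]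
  [SMul B E] [CStarModule B E]

namespace AnticommPair

variable {S T : E →ₗ.[ℂ] E} {c M : ℝ} (h : AnticommPair B S T c M)
include h

/-- `S + T + l⁻¹ T S + m = l⁻¹ (T + l)(S + l) - (l - m)` is inverted by a Neumann series. -/
theorem exists_approx_inverse {l m : ℂ} (hm : m.re = 0) (hm' : M ≤ ‖m‖) (hl : l ∈ paramSet m) :
    ∃ R, IsAdjointableInverse B (approxOp S T l m) R := by
  obtain ⟨r, hr, hml, hl0, hstar, hlm, -⟩ := exists_real_of_mem_paramSet hm hl
  have hre := hl.1
  have hl' : M ≤ ‖l‖ := hm'.trans hl.2.1.le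
  have him := h.im_ne_zero hre hl'
  have hn : 0 < ‖l‖ := norm_pos_iff.2 hl0
  let K : E →L[ℂ] E := (res S l).comp (res T l)
  have hKa : IsAdjointable B K := (h.left.isAdjointable_res him).comp (h.right.isAdjointable_res him)
  have hKn : ‖K‖ ≤ ‖l‖⁻¹ * ‖l‖⁻¹ := by
    refine K.opNorm_le_bound (by positivity) fun y => ?_
    have h1 := h.right.norm_smul_res_le him hre y
    have h2 := h.left.norm_smul_res_le him hre (res T l y)
    change ‖res S l (res T l y)‖ ≤ _
    rw [mul_assoc, ← div_eq_inv_mul, le_div_iff₀' hn, ← div_eq_inv_mul, le_div_iff₀' hn]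
    exact (mul_le_mul_of_nonneg_left h2 hn.le).trans h1
  -- The operator to invert is `l⁻¹(1 - L)K⁻¹`, with inverse `lK(1 - L)⁻¹`.
  let L : E →L[ℂ] E := (l * (l - m)) • K
  have hL : ‖L‖ < 1 := by
    calc ‖L‖ ≤ ‖l‖ * ‖l - m‖ * (‖l‖⁻¹ * ‖l‖⁻¹) := by
          rw [norm_smul, norm_mul]; gcongr
      _ = ‖l - m‖ / ‖l‖ := by field_simp
      _ < 1 := (div_lt_one hn).2 hlm
  let W : E →L[ℂ] E := ↑(Units.oneSub L hL)⁻¹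
  have hW1 : ∀ y, W y - (l * (l - m)) • K (W y) = y := fun y => by
    have := congrArg (fun f : E →L[ℂ] E => f y) (Units.oneSub L hL).mul_inv
    simp only [Units.val_oneSub, mul_apply_eq_comp, sub_apply, one_apply_eq_self] at this
    exact this
  have hW2 : ∀ y, W (y - (l * (l - m)) • K y) = y := fun y => by
    have := congrArg (fun f : E →L[ℂ] E => f y) (Units.oneSub L hL).inv_mul
    simp only [Units.val_oneSub, mul_apply_eq_comp, sub_apply, one_apply_eq_self] at this
    exact this
  refine ⟨l • K.comp W, ⟨(hKa.comp ((hKa.smul _).inv_oneSub hL)).smul l, ?_, ?_⟩⟩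
  · rintro ⟨u, hu⟩
    obtain ⟨s, t, p, q, hd, he⟩ := mem_graph_approxOp.1 ((approxOp S T l m).mem_graph ⟨u, hu⟩)
    have k1 : (s + l • u, p + l • t) ∈ T.graph :=
      T.graph.add_mem hd.memTS (T.graph.smul_mem l hd.memT)
    have k2 := h.right.res_add him k1
    have k3 := h.left.res_add him hd.memS
    set g := p + l • t + l • (s + l • u)
    have hKg : K g = u := by
      change res S l (res T l g) = u
      rw [k2, k3]
    have e : s + t + l⁻¹ • p + m • u = l⁻¹ • (g - (l * (l - m)) • K g) := by
      rw [hKg]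
      simp only [g]
      match_scalars <;> field_simp
      ring
    rw [← he, e]
    simp only [smul_apply, ContinuousLinearMap.comp_apply, map_smul, hW2]
    rw [smul_smul, inv_mul_cancel₀ hl0, one_smul, hKg]
  · intro y
    set w := W y with hw
    have k1 := h.right.res_mem him w
    obtain ⟨v, q, a1, a2, a3, a4, -, -⟩ := h.exists_graph_res hre hl' k1
    refine mem_graph_approxOp.2 ⟨_, _, _, _, ⟨S.graph.smul_mem l a1, T.graph.smul_mem l a2,
      T.graph.smul_mem l a3, S.graph.smul_mem l a4⟩, ?_⟩
    have := hW1 y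
    rw [← hw] at this
    conv_rhs => rw [← this]
    simp only [smul_apply, ContinuousLinearMap.comp_apply, ← hw, K]
    match_scalars <;> field_simp <;> ring

omit [CompleteSpace E] in
/-- Uniform bounds for the solutions of `(S + T + l⁻¹ T S + m) u = y`. -/
theorem approx_bounds {l m : ℂ} (hm : m.re = 0) (hm' : 2 * M ≤ ‖m‖) (hl : l ∈ paramSet m)
    {u s t p q y : E} (hd : DomFData S T u s t p q) (hy : s + t + l⁻¹ • p + m • u = y) :
    ‖u‖ ≤ 2 * ‖y‖ ∧ ‖s‖ ≤ 2 * ‖y‖ ∧ ‖t‖ ≤ 2 * ‖y‖ ∧ ‖l⁻¹ • p‖ ≤ 2 * ‖y‖ ∧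
      ‖p + q‖ ≤ 6 * c * ‖y‖ := by
  obtain ⟨r, hr, hml, hl0, hstar, hlm, hre⟩ := exists_real_of_mem_paramSet hm hl
  have hc := h.pos
  have hM := h.le
  have hn : 0 < ‖l‖ := norm_pos_iff.2 hl0
  have hmn : 0 < ‖m‖ := by linarith
  have hid := inner_approx_self h.left.selfAdjoint h.right.selfAdjoint hml hl0 hstar hd
  rw [hy] at hid
  set Q := inner B s s + inner B t t + inner B (m • u) (m • u) + inner B (l⁻¹ • p) (l⁻¹ • p)
    with hQ
  set N := √‖Q‖ with hN
  have hN0 : 0 ≤ N := Real.sqrt_nonneg _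
  have hNQ : N ^ 2 = ‖Q‖ := Real.sq_sqrt (norm_nonneg _)
  have ns : 0 ≤ inner B s s := CStarModule.inner_self_nonneg
  have nt : 0 ≤ inner B t t := CStarModule.inner_self_nonneg
  have nu : 0 ≤ inner B (m • u) (m • u) := CStarModule.inner_self_nonneg
  have np : 0 ≤ inner B (l⁻¹ • p) (l⁻¹ • p) := CStarModule.inner_self_nonneg
  have key : ∀ w : E, inner B w w ≤ Q → ‖w‖ ≤ N := by
    intro w hw
    refine Real.le_sqrt_of_sq_le ?_
    rw [CStarModule.norm_sq_eq B]
    exact CStarAlgebra.norm_le_norm_of_nonneg_of_le CStarModule.inner_self_nonneg hw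
  have b1 : ‖s‖ ≤ N := key s (by
    rw [hQ, add_assoc, add_assoc]
    exact le_add_of_nonneg_right (add_nonneg nt (add_nonneg nu np)))
  have b2 : ‖t‖ ≤ N := key t (by
    rw [hQ, add_assoc, add_comm (inner B s s), add_assoc]
    exact le_add_of_nonneg_right (add_nonneg ns (add_nonneg nu np)))
  have b3 : ‖m • u‖ ≤ N := key _ (by
    rw [hQ, add_right_comm]
    exact le_add_of_nonneg_left (add_nonneg (add_nonneg ns nt) np))
  have b4 : ‖l⁻¹ • p‖ ≤ N := key _ (le_add_of_nonneg_left (add_nonneg (add_nonneg ns nt) nu))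
  rw [norm_smul] at b3
  have b5 : ‖u‖ ≤ N := (le_mul_of_one_le_left (norm_nonneg _) (by linarith)).trans b3
  have b6 : ‖p + q‖ ≤ 3 * c * N := by
    refine (h.bound _ _ _ _ _ hd.memS hd.memT hd.memTS hd.memST).trans ?_
    have : c * (‖u‖ + ‖s‖ + ‖t‖) ≤ c * (N + N + N) := by gcongr
    linarith
  have hr1 : r ≤ 1 := by
    rw [hre, div_le_one hn]; exact hl.2.1.le
  have hQy : ‖Q‖ ≤ ‖y‖ ^ 2 + ‖u‖ * ‖p + q‖ + ‖l‖⁻¹ * (‖t‖ * ‖p + q‖ + ‖p + q‖ * ‖t‖) := by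
    have e : Q = inner B y y - ((1 - r : ℝ) : ℂ) • inner B u (p + q)
        - l⁻¹ • (inner B t (p + q) - inner B (p + q) t) := by rw [hid]; abel
    have i1 : ‖((1 - r : ℝ) : ℂ) • inner B u (p + q)‖ ≤ ‖u‖ * ‖p + q‖ := by
      rw [norm_smul, Complex.norm_real, Real.norm_eq_abs, abs_of_nonneg (by linarith)]
      refine (mul_le_of_le_one_left (norm_nonneg _) (by linarith)).trans ?_
      exact CStarModule.norm_inner_le E
    have i2 : ‖l⁻¹ • (inner B t (p + q) - inner B (p + q) t)‖ ≤
        ‖l‖⁻¹ * (‖t‖ * ‖p + q‖ + ‖p + q‖ * ‖t‖) := by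
      rw [norm_smul, norm_inv]
      gcongr
      refine (norm_sub_le _ _).trans ?_
      gcongr <;> exact CStarModule.norm_inner_le E
    rw [e]
    refine (norm_sub_le _ _).trans (add_le_add ((norm_sub_le _ _).trans (add_le_add ?_ i1)) i2)
    rw [CStarModule.norm_sq_eq B]
  have j1 : ‖m‖ * (‖u‖ * ‖p + q‖) ≤ 3 * c * N ^ 2 := by
    calc ‖m‖ * (‖u‖ * ‖p + q‖) = (‖m‖ * ‖u‖) * ‖p + q‖ := by ring
      _ ≤ N * (3 * c * N) := by gcongr
      _ = _ := by ring
  have j2 : ‖m‖ * (‖l‖⁻¹ * (‖t‖ * ‖p + q‖ + ‖p + q‖ * ‖t‖)) ≤ 6 * c * N ^ 2 := by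
    have hml1 : ‖m‖ * ‖l‖⁻¹ ≤ 1 := by rw [← div_eq_mul_inv, ← hre]; exact hr1
    calc _ = (‖m‖ * ‖l‖⁻¹) * (2 * (‖t‖ * ‖p + q‖)) := by ring
      _ ≤ 1 * (2 * (N * (3 * c * N))) := by gcongr
      _ = _ := by ring
  have j3 : ‖m‖ * N ^ 2 ≤ ‖m‖ * ‖y‖ ^ 2 + 9 * c * N ^ 2 := by
    rw [hNQ] at *
    have := mul_le_mul_of_nonneg_left hQy hmn.le
    linarith
  -- The mixed terms cost `9cN²`, at most half of `|m|N²` as `|m| ≥ 2M ≥ 24c + 2`.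
  have j4 : 18 * c * N ^ 2 ≤ ‖m‖ * N ^ 2 :=
    mul_le_mul_of_nonneg_right (by linarith) (sq_nonneg _)
  have j5 : N ^ 2 ≤ 2 * ‖y‖ ^ 2 := by
    have : ‖m‖ * N ^ 2 ≤ ‖m‖ * (2 * ‖y‖ ^ 2) := by linarith
    exact le_of_mul_le_mul_left this hmn
  have j6 : N ≤ 2 * ‖y‖ := by
    refine le_of_sq_le_sq ?_ (by positivity)
    nlinarith [sq_nonneg ‖y‖]
  refine ⟨b5.trans j6, b1.trans j6, b2.trans j6, b4.trans j6, b6.trans ?_⟩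
  have : c * N ≤ c * (2 * ‖y‖) := by gcongr
  linarith

omit [CompleteSpace E] in
/-- The error `l⁻¹ T S u` of a solution of `(S + T + l⁻¹ T S + m) u = y` with `y ∈ D(T)`. -/
theorem approx_error_sq_le {l m : ℂ} (hm : m.re = 0) (hm' : 2 * M ≤ ‖m‖) (hl : l ∈ paramSet m)
    {u s t p q y ty : E} (hd : DomFData S T u s t p q) (hy : s + t + l⁻¹ • p + m • u = y)
    (hty : (y, ty) ∈ T.graph) :
    ‖l⁻¹ • p‖ ^ 2 ≤
      (4 * ‖y‖ * ‖ty‖ + 24 * c * ‖y‖ ^ 2 + 12 * c * ‖m‖ * ‖y‖ ^ 2) * ‖l‖⁻¹ := by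
  obtain ⟨b1, b2, b3, b4, b5⟩ := h.approx_bounds hm hm' hl hd hy
  obtain ⟨r, hr, hml, hl0, hstar, hlm, hre⟩ := exists_real_of_mem_paramSet hm hl
  have hc := h.pos
  have hn : 0 < ‖l‖ := norm_pos_iff.2 hl0
  have hT := h.right.selfAdjoint
  have hS := h.left.selfAdjoint
  have hli : star (l⁻¹) = -l⁻¹ := by rw [star_inv₀, hstar, inv_neg]
  have e3 := hT.symm hd.memTS hd.memT
  have e5 := hS.symm hd.memS hd.memST
  have e6 := hT.symm hd.memTS hd.memTS
  have e7 := hS.symm hd.memST hd.memST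
  have e8 : inner B (l⁻¹ • p) y = -l⁻¹ • inner B s ty := by
    rw [CStarModule.inner_smul_left_complex, hli, hT.symm hd.memTS hty]
  have e9 : inner B y (l⁻¹ • p) = l⁻¹ • inner B ty s := by
    rw [CStarModule.inner_smul_right_complex, hT.symm hty hd.memTS]
  -- Pair the equation with `l⁻¹p` symmetrically. As `y ∈ D(T)`, moving `T` onto `y` leaves the
  -- factor `l⁻¹` in front of bounded terms; the remaining coefficient `r` is `|m|/|l|`.
  have hid : (2 : ℂ) • inner B (l⁻¹ • p) (l⁻¹ • p) =
      -l⁻¹ • inner B s ty + l⁻¹ • inner B ty s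
        - l⁻¹ • (inner B t (p + q) - inner B (p + q) t) + (r : ℂ) • inner B u (p + q) := by
    rw [← e8, ← e9, ← hy]
    simp only [CStarModule.inner_add_left, CStarModule.inner_add_right,
      CStarModule.inner_smul_left_complex, CStarModule.inner_smul_right_complex, hli,
      e3, e5, e6, e7, hml]
    have hrl : star ((r : ℂ) * l) = -(r * l) := by
      rw [star_mul', hstar]; simp
    rw [hrl]
    match_scalars <;> field_simp <;> ring
  have i1 : ‖(2 : ℂ) • inner B (l⁻¹ • p) (l⁻¹ • p)‖ = 2 * ‖l⁻¹ • p‖ ^ 2 := by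
    rw [norm_smul, CStarModule.norm_sq_eq B]; simp
  have i2 : ‖-l⁻¹ • inner B s ty‖ ≤ ‖l‖⁻¹ * (2 * ‖y‖ * ‖ty‖) := by
    rw [norm_smul, norm_neg, norm_inv]
    gcongr
    exact (CStarModule.norm_inner_le E).trans (by gcongr)
  have i3 : ‖l⁻¹ • inner B ty s‖ ≤ ‖l‖⁻¹ * (‖ty‖ * (2 * ‖y‖)) := by
    rw [norm_smul, norm_inv]
    gcongr
    exact (CStarModule.norm_inner_le E).trans (by gcongr)
  have i4 : ‖l⁻¹ • (inner B t (p + q) - inner B (p + q) t)‖ ≤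
      ‖l‖⁻¹ * (2 * ‖y‖ * (6 * c * ‖y‖) + 6 * c * ‖y‖ * (2 * ‖y‖)) := by
    rw [norm_smul, norm_inv]
    gcongr
    refine (norm_sub_le _ _).trans (add_le_add ?_ ?_) <;>
    exact (CStarModule.norm_inner_le E).trans (by gcongr)
  have i5 : ‖(r : ℂ) • inner B u (p + q)‖ ≤
      ‖m‖ * ‖l‖⁻¹ * (2 * ‖y‖ * (6 * c * ‖y‖)) := by
    rw [norm_smul, Complex.norm_real, Real.norm_eq_abs, abs_of_pos hr, hre, div_eq_mul_inv]
    gcongr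
    exact (CStarModule.norm_inner_le E).trans (by gcongr)
  have i6 := (norm_add_le _ _).trans (add_le_add ((norm_sub_le _ _).trans
    (add_le_add ((norm_add_le _ _).trans (add_le_add i2 i3)) i4)) i5)
  rw [← hid, i1] at i6
  have i7 : 0 ≤ ‖l⁻¹ • p‖ ^ 2 := sq_nonneg _
  calc ‖l⁻¹ • p‖ ^ 2 ≤ 2 * ‖l⁻¹ • p‖ ^ 2 := by linarith
    _ ≤ _ := i6
    _ = _ := by ring

end AnticommPair

end Sum

/-! ### Self-adjointness, regularity and convergence for `S + T`. -/

section Sum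

variable {B : Type*} [NonUnitalCStarAlgebra B] [PartialOrder B] [StarOrderedRing B]
  {E : Type*} [NormedAddCommGroup E] [NormedSpace ℂ E]
  [SMul B E] [CStarModule B E]

/-- The graph norm of `S + T` dominates the graph norms of `S` and `T`. -/
def SumBound (S T : E →ₗ.[ℂ] E) (K : ℝ) : Prop :=
  ∀ x s t, (x, s) ∈ S.graph → (x, t) ∈ T.graph →
    ‖s‖ ≤ K * (‖x‖ + ‖s + t‖) ∧ ‖t‖ ≤ K * (‖x‖ + ‖s + t‖)

theorem SumBound.isClosed [CompleteSpace E] {S T : E →ₗ.[ℂ] E} {K : ℝ} (hK : SumBound S T K)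
    (hS : S.IsClosed) (hT : T.IsClosed) (hK0 : 0 ≤ K) : (S + T).IsClosed := by
  let fst := ContinuousLinearMap.fst ℂ (E × E) (E × E)
  let snd := ContinuousLinearMap.snd ℂ (E × E) (E × E)
  let x := (ContinuousLinearMap.fst ℂ E E).comp fst
  let y := (ContinuousLinearMap.snd ℂ E E).comp fst
  let s := (ContinuousLinearMap.fst ℂ E E).comp snd
  let t := (ContinuousLinearMap.snd ℂ E E).comp snd
  -- Tuples `((x, y), (s, t))` with `s = Sx`, `t = Tx`, `s + t = y`: a closed relation over the
  -- graph of `S + T`, bounded by `SumBound`.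
  let Γ : Submodule ℂ ((E × E) × (E × E)) :=
    S.graph.comap (x.prod s).toLinearMap ⊓ T.graph.comap (x.prod t).toLinearMap ⊓
      LinearMap.ker (s + t - y).toLinearMap
  have hΓ : ∀ x y s t, ((x, y), (s, t)) ∈ Γ ↔ ((x, s) ∈ S.graph ∧ (x, t) ∈ T.graph) ∧
      s + t - y = 0 := fun _ _ _ _ => Iff.rfl
  have hcl : IsClosed (Γ : Set ((E × E) × (E × E))) :=
    ((hS.preimage (x.prod s).continuous).inter (hT.preimage (x.prod t).continuous)).inter
      (s + t - y).isClosed_ker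
  have himg := isClosed_image_fst Γ hcl (2 * K) (by
    rintro ⟨⟨x, y⟩, ⟨s, t⟩⟩ hm
    obtain ⟨⟨h1, h2⟩, h3⟩ := (hΓ x y s t).1 hm
    obtain ⟨k1, k2⟩ := hK x s t h1 h2
    rw [sub_eq_zero.1 h3] at k1 k2
    have hx : ‖x‖ ≤ ‖(x, y)‖ := le_max_left _ _
    have hy : ‖y‖ ≤ ‖(x, y)‖ := le_max_right _ _
    have : K * (‖x‖ + ‖y‖) ≤ K * (‖(x, y)‖ + ‖(x, y)‖) := by gcongr
    change max ‖s‖ ‖t‖ ≤ _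
    apply max_le <;> linarith)
  suffices hgr : ((S + T).graph : Set (E × E)) = Prod.fst '' (Γ : Set ((E × E) × (E × E))) by
    rwa [LinearPMap.IsClosed, hgr]
  ext ⟨a, b⟩
  constructor
  · intro hab
    obtain ⟨u, v, hu, hv, he⟩ := mem_graph_add.1 hab
    exact ⟨((a, b), (u, v)), (hΓ _ _ _ _).2 ⟨⟨hu, hv⟩, sub_eq_zero.2 he⟩, rfl⟩
  · rintro ⟨⟨⟨a', b'⟩, ⟨u, v⟩⟩, hm, he⟩
    simp only [Prod.mk.injEq] at he
    obtain ⟨rfl, rfl⟩ := he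
    obtain ⟨⟨h1, h2⟩, h3⟩ := (hΓ _ _ _ _).1 hm
    exact mem_graph_add.2 ⟨u, v, h1, h2, sub_eq_zero.1 h3⟩

omit [StarOrderedRing B] in
theorem inner_add_symm {S T : E →ₗ.[ℂ] E} (hS : IsSelfAdjointOp B S) (hT : IsSelfAdjointOp B T)
    {x u y v : E} (h1 : (x, u) ∈ (S + T).graph) (h2 : (y, v) ∈ (S + T).graph) :
    inner B u y = inner B x v := by
  obtain ⟨s, t, hs, ht, rfl⟩ := mem_graph_add.1 h1
  obtain ⟨s', t', hs', ht', rfl⟩ := mem_graph_add.1 h2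
  rw [CStarModule.inner_add_left, CStarModule.inner_add_right, hS.symm hs hs', hT.symm ht ht']

omit [StarOrderedRing B] in
/-- A densely defined `B`-linear symmetric operator `A` with `A + m` and `A - m` surjective for some
`m` on the imaginary axis is self-adjoint and regular. -/
theorem isSelfAdjointRegular_of_shiftSurj {A : E →ₗ.[ℂ] E} (hd : Dense (A.domain : Set E))
    (hsmul : ∀ (b : B) (x : A.domain), (b • (x : E), b • A x) ∈ A.graph)
    (hsymm : ∀ {x u y v : E}, (x, u) ∈ A.graph → (y, v) ∈ A.graph → inner B u y = inner B x v)
    {m : ℂ} (hm : m.re = 0) (hm' : m.im ≠ 0) (h1 : ShiftSurj A m) (h2 : ShiftSurj A (-m)) :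
    IsSelfAdjointRegular B A := by
  have hdr : ∀ z, ShiftSurj A z → DenseRange (shift A z) := by
    intro z hz
    refine Function.Surjective.denseRange fun y => ?_
    obtain ⟨x, u, hx, rfl⟩ := hz y
    obtain ⟨w, -, hw⟩ := exists_shift_apply hx z
    exact ⟨w, hw⟩
  have hst : star m = -m := Complex.ext (by simp [hm]) (by simp)
  refine ⟨⟨hd, hsmul, fun y z => ⟨fun h x => hsymm (A.mem_graph x) h, fun h => ?_⟩⟩,
    ⟨m, hm', hdr _ h1, hdr _ h2⟩⟩
  -- If `(y, z)` is in the adjoint graph, surjectivity of `A + m` supplies `w ∈ D(A)` with the same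
  -- image, and surjectivity of `A - m` forces `y = w`.
  obtain ⟨w, v, hw, hwe⟩ := h1 (z + m • y)
  have hyw : y = w := by
    refine inner_right_ext B fun x => ?_
    obtain ⟨x', u, hx', rfl⟩ := h2 x
    have e1 : inner B u y = inner B x' z := by
      obtain ⟨a, rfl, rfl⟩ := (LinearPMap.mem_graph_iff _).1 hx'
      exact h a
    have e2 : inner B u w = inner B x' v := hsymm hx' hw
    have e3 : v = z + m • y - m • w := by rw [← hwe]; abel
    have hst' : star (-m) = m := by rw [star_neg, hst, neg_neg]
    rw [CStarModule.inner_add_left, CStarModule.inner_add_left,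
      CStarModule.inner_smul_left_complex, CStarModule.inner_smul_left_complex, hst', e1, e2, e3,
      CStarModule.inner_sub_right, CStarModule.inner_add_right,
      CStarModule.inner_smul_right_complex, CStarModule.inner_smul_right_complex]
    abel
  rw [hyw]
  have : v = z := by
    rw [hyw] at hwe
    exact add_right_cancel hwe
  rwa [← this]

variable [CompleteSpace E]

namespace AnticommPair

variable {S T : E →ₗ.[ℂ] E} {c M : ℝ} (h : AnticommPair B S T c M)
include h

theorem sum_dense_domain : Dense ((S + T).domain : Set E) := by
  intro x
  refine closure_minimal ?_ isClosed_closure (h.right.selfAdjoint.dense_domain x)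
  intro y hy
  obtain ⟨u, a, b, h1, h2, -, -⟩ := h.exists_tendsto_domF (mem_graph_of_mem hy)
  exact mem_closure_of_tendsto h2 (h1.mono fun n hn =>
    ⟨domF_le_left S T hn.1, domF_le_right S T hn.1⟩)

theorem sum_shiftSurj {K : ℝ} (hK0 : 0 ≤ K) (hK : SumBound S T K) {m : ℂ} (hm : m.re = 0)
    (hm' : 2 * M ≤ ‖m‖) : ShiftSurj (S + T) m := by
  have hc := h.pos
  have hM := h.le
  have hmn : 0 < ‖m‖ := by linarith
  refine shiftSurj_of_denseRange
    (hK.isClosed h.left.selfAdjoint.isClosed h.right.selfAdjoint.isClosed hK0) (k := ‖m‖⁻¹) ?_ ?_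
  · intro x u hx
    have := norm_le_right_of_inner_eq_add B (inner_add_smul_self_of_re_eq_zero B
      (inner_add_symm h.left.selfAdjoint h.right.selfAdjoint hx hx) hm)
    rw [norm_smul] at this
    rwa [← div_eq_inv_mul, le_div_iff₀' hmn]
  · intro y
    refine closure_minimal ?_ isClosed_closure (h.right.selfAdjoint.dense_domain y)
    intro x hx
    have hxT := mem_graph_of_mem hx
    set tx := T ⟨x, hx⟩
    -- The shift by `2` keeps `|l| > |m|` strict at `n = 0`.
    let l : ℕ → ℂ := fun n => ((n + 2 : ℝ) : ℂ) * m
    have hln : ∀ n, ‖l n‖ = (n + 2) * ‖m‖ := fun n => by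
      simp only [l, norm_mul, Complex.norm_real, Real.norm_eq_abs]
      rw [abs_of_pos (by positivity)]
    have hl : ∀ n, l n ∈ paramSet m := by
      intro n
      refine ⟨by simp [l, hm], ?_, ?_⟩
      · rw [hln]; nlinarith [(Nat.cast_nonneg n : (0 : ℝ) ≤ n)]
      · have : m / l n = (((n + 2 : ℝ)⁻¹ : ℝ) : ℂ) := by
          have hm0 : m ≠ 0 := norm_pos_iff.1 hmn
          have hn2 : ((n + 2 : ℝ) : ℂ) ≠ 0 := by
            rw [Complex.ofReal_ne_zero]; positivity
          simp only [l]
          rw [Complex.ofReal_inv]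
          field_simp
        rw [this, Complex.ofReal_re]; positivity
    have hlim : Tendsto (fun n => ‖l n‖) atTop atTop := by
      simp only [hln]
      exact (tendsto_atTop_add_const_right _ _ tendsto_natCast_atTop_atTop).atTop_mul_const hmn
    have hex : ∀ n, ∃ u s t p q, DomFData S T u s t p q ∧
        s + t + (l n)⁻¹ • p + m • u = x := by
      intro n
      obtain ⟨R, hR⟩ := h.exists_approx_inverse hm (by linarith) (hl n)
      exact ⟨R x, mem_graph_approxOp.1 (hR.right_inv x)⟩
    choose u s t p q hd he using hex
    have herr : Tendsto (fun n => (l n)⁻¹ • p n) atTop (𝓝 0) := by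
      rw [tendsto_zero_iff_norm_tendsto_zero]
      have h0 : Tendsto (fun n => ‖(l n)⁻¹ • p n‖ ^ 2) atTop (𝓝 0) := by
        refine squeeze_zero (fun n => sq_nonneg _)
          (fun n => h.approx_error_sq_le hm hm' (hl n) (hd n) (he n) hxT) ?_
        simpa using (tendsto_inv_atTop_zero.comp hlim).const_mul _
      have h1 := (Real.continuous_sqrt.tendsto _).comp h0
      rw [Real.sqrt_zero] at h1
      refine h1.congr fun n => ?_
      exact Real.sqrt_sq (norm_nonneg _)
    have hx' : Tendsto (fun n => x - (l n)⁻¹ • p n) atTop (𝓝 x) := by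
      simpa using (tendsto_const_nhds (x := x)).sub herr
    refine mem_closure_of_tendsto hx' (Eventually.of_forall fun n => ?_)
    have hg : (u n, s n + t n) ∈ (S + T).graph :=
      mem_graph_add.2 ⟨_, _, (hd n).memS, (hd n).memT, rfl⟩
    obtain ⟨w, -, hw⟩ := exists_shift_apply hg m
    refine ⟨w, hw.trans ?_⟩
    conv_rhs => rw [← he n]
    abel

theorem sum_isSelfAdjointRegular {K : ℝ} (hK0 : 0 ≤ K) (hK : SumBound S T K) :
    IsSelfAdjointRegular B (S + T) := by
  have hc := h.pos
  have hM := h.le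
  have hM0 : 0 < 2 * M := by linarith
  let m : ℂ := ((2 * M : ℝ) : ℂ) * Complex.I
  have hm : m.re = 0 := by simp [m]
  have hmn : ‖m‖ = 2 * M := by
    rw [norm_mul, Complex.norm_real, Complex.norm_I, mul_one]
    exact abs_of_pos hM0
  refine isSelfAdjointRegular_of_shiftSurj h.sum_dense_domain ?_
    (fun h1 h2 => inner_add_symm h.left.selfAdjoint h.right.selfAdjoint h1 h2) hm
    (im_ne_zero_of_re_eq_zero hm (by rw [hmn]; exact hM0))
    (h.sum_shiftSurj hK0 hK hm hmn.ge)
    (h.sum_shiftSurj hK0 hK (by simpa using hm) (by rw [norm_neg, hmn]))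
  rintro b ⟨x, h1, h2⟩
  rw [mem_graph_add]
  refine ⟨_, _, h.left.selfAdjoint.smul_mem_graph b ⟨x, h1⟩,
    h.right.selfAdjoint.smul_mem_graph b ⟨x, h2⟩, ?_⟩
  -- The action of `B` is only an `SMul`; its additivity is read off from inner products.
  refine inner_right_ext B fun w => ?_
  rw [LinearPMap.add_apply]
  simp only [CStarModule.inner_add_right, CStarModule.inner_op_smul_right, mul_add]

theorem hasCore_sum (hcl : (S + T).IsClosed) : (S + T).HasCore (domF S T) := by
  refine hasCore_of_tendsto hcl (le_inf (domF_le_left S T) (domF_le_right S T))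
    fun x y hxy => ?_
  obtain ⟨s, t, hs, ht, rfl⟩ := mem_graph_add.1 hxy
  obtain ⟨u, a, b, h1, h2, h3, h4⟩ := h.exists_tendsto_domF ht
  exact ⟨u, fun n => a n + b n, h1.mono fun n hn => hn.1,
    h1.mono fun n hn => mem_graph_add.2 ⟨_, _, hn.2.1, hn.2.2, rfl⟩, h2, (h4 s hs).add h3⟩

/-- `(S + T + m)⁻¹ T` is bounded. -/
theorem norm_res_sum_le {K : ℝ} (hK0 : 0 ≤ K) (hK : SumBound S T K)
    (hD : IsSelfAdjointRegular B (S + T)) {m : ℂ} (hm : m.re = 0) (hm' : 1 ≤ ‖m‖) {s p : E}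
    (hs : (s, p) ∈ T.graph) : ‖res (S + T) m p‖ ≤ 2 * K * ‖s‖ := by
  have him := im_ne_zero_of_re_eq_zero hm (by linarith)
  set g := res (S + T) m p with hg
  have him' : (star m).im ≠ 0 := by simpa using him
  have hre' : (star m).re = 0 := by simpa using hm
  have hn' : ‖star m‖ = ‖m‖ := norm_star m
  have h1 := hD.res_mem him' g
  obtain ⟨a, b, ha, hb, hab⟩ := mem_graph_add.1 h1
  have h2 := (hK _ _ _ ha hb).2
  have h3 := hD.norm_sub_res_le him' hre' g
  have h4 := hD.norm_smul_res_le him' hre' g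
  rw [hn'] at h4
  have h5 : ‖res (S + T) (star m) g‖ ≤ ‖g‖ :=
    (le_mul_of_one_le_left (norm_nonneg _) hm').trans h4
  have h6 : ‖b‖ ≤ 2 * K * ‖g‖ := by
    rw [hab] at h2
    have : K * (‖res (S + T) (star m) g‖ + ‖g - star m • res (S + T) (star m) g‖) ≤
      K * (‖g‖ + ‖g‖) := by gcongr
    linarith
  have h7 : ‖g‖ ^ 2 ≤ ‖s‖ * (2 * K * ‖g‖) := by
    rw [CStarModule.norm_sq_eq B]
    -- With `b = T(S+T+m̄)⁻¹g` this is the duality between `(S+T+m)⁻¹T` and `T(S+T+m̄)⁻¹`; the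
    -- latter is bounded by the graph norm estimate.
    have e : inner B g g = inner B s b := by
      conv_lhs => rw [hg]
      rw [hD.inner_res him, ← hg]
      exact h.right.selfAdjoint.symm hs hb
    rw [e]
    exact (CStarModule.norm_inner_le E).trans (by gcongr)
  rcases (norm_nonneg g).eq_or_lt with h0 | h0
  · rw [← h0]; positivity
  · nlinarith

/-- The convergence of the approximate resolvents. -/
theorem approx_tendsto {K : ℝ} (hK0 : 0 ≤ K) (hK : SumBound S T K)
    (hD : IsSelfAdjointRegular B (S + T)) {m : ℂ} (hm : m.re = 0) (hm' : 2 * M ≤ ‖m‖)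
    {R : ℂ → E →L[ℂ] E} (hR : ∀ l ∈ paramSet m, IsAdjointableInverse B (approxOp S T l m) (R l)) :
    (∀ x : E, ∃ u : ℂ → (shift (S + T) m).domain,
      (∀ l ∈ paramSet m, (u l : E) = R l x) ∧
      Tendsto (fun l => shift (S + T) m (u l)) (paramFilter m) (𝓝 x)) ∧
    Tendsto R (paramFilter m) (𝓝 (res (S + T) m)) := by
  have hc := h.pos
  have hM := h.le
  have him := im_ne_zero_of_re_eq_zero hm (by linarith)
  have hev : ∀ᶠ l in paramFilter m, l ∈ paramSet m :=
    (mem_inf_of_right (mem_principal_self _) : paramSet m ∈ paramFilter m)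
  have hlim : Tendsto (fun l : ℂ => ‖l‖⁻¹) (paramFilter m) (𝓝 0) :=
    tendsto_inv_atTop_zero.comp (tendsto_norm_cobounded_atTop.mono_left inf_le_left)
  have hex : ∀ l x, ∃ s t p q, l ∈ paramSet m →
      DomFData S T (R l x) s t p q ∧ s + t + l⁻¹ • p + m • R l x = x := by
    intro l x
    by_cases hl : l ∈ paramSet m
    · obtain ⟨s, t, p, q, hd⟩ := mem_graph_approxOp.1 ((hR l hl).right_inv x)
      exact ⟨s, t, p, q, fun _ => hd⟩
    · exact ⟨0, 0, 0, 0, fun h' => absurd h' hl⟩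
  choose s t p q hdat using hex
  have hgr : ∀ l x, l ∈ paramSet m → (R l x, s l x + t l x) ∈ (S + T).graph := fun l x hl =>
    mem_graph_add.2 ⟨_, _, (hdat l x hl).1.memS, (hdat l x hl).1.memT, rfl⟩
  have herrT : ∀ x tx, (x, tx) ∈ T.graph →
      Tendsto (fun l => ‖l⁻¹ • p l x‖) (paramFilter m) (𝓝 0) := by
    intro x tx hx
    have h0 : Tendsto (fun l => ‖l⁻¹ • p l x‖ ^ 2) (paramFilter m) (𝓝 0) := by
      refine squeeze_zero' (Eventually.of_forall fun n => sq_nonneg _)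
        (hev.mono fun l hl => h.approx_error_sq_le hm hm' hl (hdat l x hl).1 (hdat l x hl).2 hx) ?_
      simpa using hlim.const_mul _
    have h1 := (Real.continuous_sqrt.tendsto _).comp h0
    rw [Real.sqrt_zero] at h1
    exact h1.congr fun n => Real.sqrt_sq (norm_nonneg _)
  -- From `D(T)` to all of `E` by density and the uniform bound `‖l⁻¹p‖ ≤ 2‖y‖` applied to
  -- differences.
  have herr : ∀ x, Tendsto (fun l => l⁻¹ • p l x) (paramFilter m) (𝓝 0) := by
    intro x
    rw [Metric.tendsto_nhds]
    intro ε hε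
    obtain ⟨w, hw, hwx⟩ := Metric.mem_closure_iff.1 (h.right.selfAdjoint.dense_domain x) (ε / 4)
      (by positivity)
    rw [dist_eq_norm] at hwx
    have h1 := herrT w _ (mem_graph_of_mem hw)
    filter_upwards [hev, h1.eventually_lt_const (show (0 : ℝ) < ε / 2 by positivity)] with l hl h2
    rw [dist_zero_right]
    have h3 := (h.approx_bounds hm hm' hl ((hdat l x hl).1.sub (hdat l w hl).1)
      (y := x - w) (by
        conv_rhs => rw [← (hdat l x hl).2, ← (hdat l w hl).2]
        module)).2.2.2.1
    have e : l⁻¹ • p l x = l⁻¹ • (p l x - p l w) + l⁻¹ • p l w := by module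
    rw [e]
    have := norm_add_le (l⁻¹ • (p l x - p l w)) (l⁻¹ • p l w)
    linarith
  refine ⟨fun x => ?_, ?_⟩
  · have hu : ∀ l, ∃ w : (shift (S + T) m).domain, l ∈ paramSet m →
        (w : E) = R l x ∧ shift (S + T) m w = s l x + t l x + m • R l x := by
      intro l
      by_cases hl : l ∈ paramSet m
      · obtain ⟨w, hw⟩ := exists_shift_apply (hgr l x hl) m
        exact ⟨w, fun _ => hw⟩
      · exact ⟨0, fun h' => absurd h' hl⟩
    choose u hu using hu
    refine ⟨u, fun l hl => (hu l hl).1, ?_⟩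
    have h1 : Tendsto (fun l => x - l⁻¹ • p l x) (paramFilter m) (𝓝 x) := by
      simpa using (tendsto_const_nhds (x := x)).sub (herr x)
    refine h1.congr' (hev.mono fun l hl => ?_)
    change _ = shift (S + T) m (u l)
    rw [(hu l hl).2, sub_eq_iff_eq_add]
    conv_lhs => rw [← (hdat l x hl).2]
    abel
  · rw [tendsto_iff_norm_sub_tendsto_zero]
    -- The difference at `x` is `-l⁻¹(S+T+m)⁻¹T s` with `s = S R_l x`; the factors `2K` and `‖s‖ ≤
    -- 2‖x‖` give the constant.
    have hb : ∀ l ∈ paramSet m, ‖R l - res (S + T) m‖ ≤ 4 * K * ‖l‖⁻¹ := by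
      intro l hl
      refine ContinuousLinearMap.opNorm_le_bound _ (by positivity) fun x => ?_
      obtain ⟨hd, he⟩ := hdat l x hl
      have h1 := hD.res_add him (hgr l x hl)
      have h2 : s l x + t l x + m • R l x = x - l⁻¹ • p l x := by
        rw [eq_sub_iff_add_eq]
        conv_rhs => rw [← he]
        abel
      rw [h2, map_sub, map_smul] at h1
      rw [sub_apply, ← h1, sub_sub_cancel_left, norm_neg, norm_smul, norm_inv]
      have h3 := h.norm_res_sum_le hK0 hK hD hm (by linarith) hd.memTS
      have h4 := (h.approx_bounds hm hm' hl hd he).2.1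
      calc ‖l‖⁻¹ * ‖res (S + T) m (p l x)‖ ≤ ‖l‖⁻¹ * (2 * K * (2 * ‖x‖)) := by
            gcongr
            exact h3.trans (by gcongr)
        _ = _ := by ring
    refine squeeze_zero' (Eventually.of_forall fun l => norm_nonneg _) (hev.mono hb) ?_
    simpa using hlim.const_mul (4 * K)

theorem image_res_right {m : ℂ} (hm : m.re = 0) (hm' : M ≤ ‖m‖) :
    res T m '' (S.domain : Set E) = domF S T := by
  ext x
  constructor
  · rintro ⟨y, hy, rfl⟩
    exact h.res_right_mem_domF hm hm' (mem_graph_of_mem hy)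
  · intro hx
    obtain ⟨s, t, p, q, h1, h2, h3, h4⟩ := mem_domF_iff.1 hx
    exact ⟨t + m • x, S.mem_domain_of_mem_graph (S.graph.add_mem h4 (S.graph.smul_mem m h1)),
      h.right.res_add (h.im_ne_zero hm hm') h2⟩

theorem range_res_res {l m : ℂ} (hl : l.re = 0) (hl' : M ≤ ‖l‖) (hm : m.re = 0)
    (hm' : M ≤ ‖m‖) : Set.range (fun x => res T m (res S l x)) = domF S T := by
  rw [← h.image_res_right hm hm']
  ext x
  constructor
  · rintro ⟨y, rfl⟩
    exact ⟨_, S.mem_domain_of_mem_graph (h.left.res_mem (h.im_ne_zero hl hl') y), rfl⟩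
  · rintro ⟨y, hy, rfl⟩
    exact ⟨S ⟨y, hy⟩ + l • y, by
      simp only [h.left.res_add (h.im_ne_zero hl hl') (mem_graph_of_mem hy)]⟩

end AnticommPair

end Sum

end HilbertMod

/-! ### Assembly of the theorem. -/

open HilbertMod
theorem theorem2p7 {B : Type*} [NonUnitalCStarAlgebra B] [PartialOrder B] [StarOrderedRing B]
    {E : Type*} [NormedAddCommGroup E] [NormedSpace ℂ E] [CompleteSpace E]
    [SMul B E] [CStarModule B E]
    (S T : E →ₗ.[ℂ] E) (hST : IsWeaklyAnticommuting B S T) :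
    -- `S + T` (with domain `D(S) ∩ D(T)`) is self-adjoint and regular, that is, `S x + T x + z x = y`
    -- is uniquely solvable in `D(S) ∩ D(T)` for all non-real `z`
    IsSelfAdjointRegular B (S + T) ∧
    (∀ z : ℂ, z.im ≠ 0 → ∀ y : E, ∃! x : (S + T).domain, (S + T) x + z • (x : E) = y) ∧
    -- (1)
    (∃ C : ℝ, 0 < C ∧ ∀ (x : E) (hS : x ∈ S.domain) (hT : x ∈ T.domain),
      C⁻¹ • (inner B x x + inner B (S ⟨x, hS⟩ + T ⟨x, hT⟩) (S ⟨x, hS⟩ + T ⟨x, hT⟩)) ≤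
          inner B x x + inner B (S ⟨x, hS⟩) (S ⟨x, hS⟩) + inner B (T ⟨x, hT⟩) (T ⟨x, hT⟩) ∧
        inner B x x + inner B (S ⟨x, hS⟩) (S ⟨x, hS⟩) + inner B (T ⟨x, hT⟩) (T ⟨x, hT⟩) ≤
          C • (inner B x x + inner B (S ⟨x, hS⟩ + T ⟨x, hT⟩) (S ⟨x, hS⟩ + T ⟨x, hT⟩))) ∧
    -- (2)
    (∃ l₀ : ℝ, 0 < l₀ ∧ ∀ l m : ℂ, l.re = 0 → m.re = 0 → l₀ ≤ ‖l‖ → l₀ ≤ ‖m‖ →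
      ∃ RS RT : E →L[ℂ] E,
        IsAdjointableInverse B (shift S l) RS ∧ IsAdjointableInverse B (shift T m) RT ∧
        RT '' (S.domain : Set E) = domF S T ∧ RS '' (T.domain : Set E) = domF S T ∧
        Set.range (fun x => RT (RS x)) = domF S T ∧
        Set.range (fun x => RS (RT x)) = domF S T) ∧
    -- (3)
    (∃ l₀ : ℝ, 0 < l₀ ∧ ∀ m : ℂ, m.re = 0 → l₀ ≤ ‖m‖ →
      ∃ (R : ℂ → E →L[ℂ] E) (Rm : E →L[ℂ] E),
        (∀ l ∈ paramSet m, IsAdjointableInverse B (approxOp S T l m) (R l)) ∧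
        IsAdjointableInverse B (shift (S + T) m) Rm ∧
        (∀ x : E, ∃ u : ℂ → (shift (S + T) m).domain,
          (∀ l ∈ paramSet m, (u l : E) = R l x) ∧
          Tendsto (fun l => shift (S + T) m (u l)) (paramFilter m) (𝓝 x)) ∧
        Tendsto R (paramFilter m) (𝓝 Rm)) ∧
    -- (4)
    S.HasCore (domF S T) ∧ T.HasCore (domF S T) ∧ (S + T).HasCore (domF S T) := by
  obtain ⟨C₀, C₁, C₂, h₀, h₁, h₂, hC⟩ := hST.exists_formBound
  obtain ⟨c, M, h⟩ := hST.exists_anticommPair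
  have hc := h.pos
  have hM := h.le
  set C := 2 + (C₀ + C₁ + C₂) with hCdef
  have hC2 : 2 ≤ C := by linarith
  have hle : ∀ x s t, (x, s) ∈ S.graph → (x, t) ∈ T.graph →
      inner B x x + inner B s s + inner B t t ≤
        C • (inner B x x + inner B (s + t) (s + t)) :=
    fun x s t hs ht => h.inner_add_le h₀ h₁ h₂ hC hs ht
  have hK : SumBound S T C := fun x s t hs ht =>
    norm_le_of_inner_add_le (by linarith) (hle x s t hs ht)
  have hC0 : 0 ≤ C := by linarith
  have hD : IsSelfAdjointRegular B (S + T) := h.sum_isSelfAdjointRegular hC0 hK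
  refine ⟨hD, ?_, ⟨C, by linarith, fun x hS hT => ⟨?_, hle x _ _ (mem_graph_of_mem hS)
    (mem_graph_of_mem hT)⟩⟩, ⟨M, by linarith, fun l m hl hm hl' hm' => ?_⟩,
    ⟨2 * M, by linarith, fun m hm hm' => ?_⟩, h.hasCore_left, h.hasCore_right,
    h.hasCore_sum hD.selfAdjoint.isClosed⟩
  · intro z hz y
    refine ⟨⟨res (S + T) z y, LinearPMap.mem_domain_of_mem_graph (hD.res_mem hz y)⟩, ?_, ?_⟩
    · simp only [apply_eq_of_mem_graph (hD.res_mem hz y), sub_add_cancel]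
    · rintro x rfl
      exact Subtype.ext (hD.res_add hz ((S + T).mem_graph x)).symm
  · rw [inv_smul_le_iff_of_pos (by linarith)]
    exact add_inner_le_smul hC2 x _ _
  · have h1 := h.symm.image_res_right hl hl'
    have h2 := h.symm.range_res_res hm hm' hl hl'
    rw [domF_comm] at h1 h2
    exact ⟨res S l, res T m, h.left.isAdjointableInverse_res (h.im_ne_zero hl hl'),
      h.right.isAdjointableInverse_res (h.im_ne_zero hm hm'), h.image_res_right hm hm', h1,
      h.range_res_res hl hl' hm hm', h2⟩
  · have hex : ∀ l, ∃ R : E →L[ℂ] E, l ∈ paramSet m →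
        IsAdjointableInverse B (approxOp S T l m) R := by
      intro l
      by_cases hl : l ∈ paramSet m
      · obtain ⟨R, hR⟩ := h.exists_approx_inverse hm (by linarith) hl
        exact ⟨R, fun _ => hR⟩
      · exact ⟨0, fun h' => absurd h' hl⟩
    choose R hR using hex
    obtain ⟨h1, h2⟩ := h.approx_tendsto hC0 hK hD hm hm' hR
    exact ⟨R, res (S + T) m, hR,
      hD.isAdjointableInverse_res (im_ne_zero_of_re_eq_zero hm (by linarith)), h1, h2⟩
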